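/- **Setting.** Let $L>0$, $\lambda_1,\lambda_2,\lambda_3>0$, $\Lambda^->0$, $\Lambda^+=\mathrm{diag}(\lambda_1,\lambda_2,\lambda_3)$, let $\Sigma^{++}$ ($3\times3$), $\Sigma^{+-}$ ($3\times1$), $\Sigma^{-+}$ ($1\times3$) be continuous on $[0,L]$, and let $Q=(q_1,q_2,q_3)^{\mathsf T}$ and $R\in\mathbb R^{1\times3}$. Consider the linear system (the linearized congested mixed-autonomy traffic model in Riemann coordinates, $\Lambda^-=-\lambda_4$) for $w=(w^+,w^-)$, $w^+(x,t)\in\mathbb R^3$, $w^-(x,t)\in\mathbb R$: $$w^+_t+\Lambda^+w^+_x=\Sigma^{++}(x)w^++\Sigma^{+-}(x)w^-,\qquad w^-_t-\Lambda^-w^-_x=\Sigma^{-+}(x)w^+,$$ $$w^+(0,t)=Qw^-(0,t),\qquad w^-(L,t)=Rw^+(L,t)+\bar U_d(t).$$ Solutions are understood along characteristics, continuous in time with values in $L^2(0,L)$, with boundary traces locally in $L^2$. Let $K=(k_1,k_2,k_3)$ and $M$ be the $C^1$ solution on $\{0\le\xi\le x\le L\}$ of the backstepping kernel equations $$\Lambda^-K_x-K_\xi\Lambda^+=K\Sigma^{++}(\xi)+M\Sigma^{-+}(\xi),\qquad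 \Lambda^-(M_x+M_\xi)=K\Sigma^{+-}(\xi),$$ $$K(x,x)(\Lambda^++\Lambda^-I)=-\Sigma^{-+}(x),\qquad \Lambda^-M(x,0)=K(x,0)\Lambda^+Q,$$ put $\alpha=w^+$, $\beta(x)=w^-(x)-\int_0^x(K(x,\xi)w^+(\xi)+M(x,\xi)w^-(\xi))\,d\xi$, $\vartheta=(\alpha,\beta)$, and let $\mathbf L$, $N$ be the continuous kernels of the inverse transformation $w^-(x)=\beta(x)+\int_0^x(\mathbf L(x,\xi)\alpha(\xi)+N(x,\xi)\beta(\xi))\,d\xi$. Let $$\bar U(t)=\int_0^L(\mathbf L(L,\xi)\alpha(\xi,t)+N(L,\xi)\beta(\xi,t))\,d\xi-Rw^+(L,t),$$ $$V(t)=\int_0^L\Big(\sum_{i=1}^3\tfrac{A_i}{\lambda_i}e^{-\mu x/\lambda_i}\alpha_i^2(x,t)+\tfrac{B}{\Lambda^-}e^{\mu x/\Lambda^-}\beta^2(x,t)\Big)dx .$$ The event-triggered control is $\bar U_d(t)=\bar U(t_k)$ for $t\in[t_k,t_{k+1})$. Put $d(t)=\bar U_d(t)-\bar U(t)$. The execution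 times are $t_0=0$ and $$t_{k+1}=\inf\{t>t_k:\ \zeta Be^{\mu L/\Lambda^-}d^2(t)\ge\zeta\mu\sigma V(t)-m(t)\}\qquad(\inf\emptyset=\infty),$$ where in this set $d(t)=\bar U(t_k)-\bar U(t)$, and where $m(0)<0$ and (in integrated form) $$\dot m=-\eta m+Be^{\mu L/\Lambda^-}d^2-\sigma\mu V-\sum_{i=1}^3\varsigma_i\alpha_i^2(L,t)-\varsigma_4\beta^2(0,t).$$ The closed loop is considered on $[0,T)$, $T=\sup_kt_k$; thus $T=\infty$ unless the execution times accumulate. Let $p_1,p_2,p_3,p_4>0$ be constants such that, for all states in $L^2((0,L);\mathbb R^4)$, $p_1\|w\|^2\le\|\vartheta\|^2\le p_2\|w\|^2$ and $p_3\|\vartheta\|^2\le V\le p_4\|\vartheta\|^2$. Put $\lambda_{\min}=\min_{1\le i\le3}\lambda_i$ and $$\gamma=\frac{2\max_iA_i}{p_3\,\lambda_{\min}}\Big(\max_{[0,L]}\|\Sigma^{++}(x)\|+\big(1+\tfrac1{p_1}\big)\max_{[0,L]}\|\Sigma^{+-}(x)\|\Big),\qquad c=\mu(1-\sigma)-\gamma,$$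 with spectral and Euclidean norms. **Theorem.** Let $A_i,B,\mu,\sigma,\zeta>0$, $\eta\in(0,1)$, $\varsigma_1,\dots,\varsigma_4\in(0,1)$ satisfy $$\varsigma_i\le A_ie^{-\mu L/\lambda_i}\ (i=1,2,3),\qquad \varsigma_4+\sum_{i=1}^3A_iq_i^2-B\le0 .$$ Then every solution of the closed loop under the event-triggered control satisfies: 1. if $c>0$, then $\|w(t)\|_{L^2}$ converges to zero exponentially, with rate $\tfrac12\min\{c,\eta\}$: there is a constant $C$ with $\|w(t)\|_{L^2}\le Ce^{-\min\{c,\eta\}t/2}$ for all $t\in[0,T)$; 2. if $c\le\eta$, then for all $t\in[0,T)$ $$\|w(t)\|_{L^2}^2\le\frac{\max\{1,p_2p_4\}}{p_1p_3}\,e^{-(\mu(1-\sigma)-\gamma)t}\big(\|w(0)\|_{L^2}^2-m(0)\big).$$ In particular, if $p_2p_4\ge1$ (which can always be arranged by enlarging $p_2$), the constant is $p_2p_4/(p_1p_3)$. -/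

import Mathlib

open MeasureTheory Set Filter Topology

noncomputable section

namespace MixedTraffic

/-- Coefficients of the linear hyperbolic boundary control system on `[0, L]`
`w⁺_t + Λ⁺ w⁺_x = Σ⁺⁺(x) w⁺ + Σ⁺⁻(x) w⁻`, `w⁻_t - Λ⁻ w⁻_x = Σ⁻⁺(x) w⁺`,
`w⁺(0,t) = Q w⁻(0,t)`, `w⁻(L,t) = R w⁺(L,t) + input`, with three rightgoing components
`w⁺` (speeds `lam i = λ_i > 0`) and one leftgoing component `w⁻` (speed `Λ⁻ = -λ₄ > 0`,
the congested regime). -/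
structure Plant where
  L : ℝ
  lam : Fin 3 → ℝ
  lamMinus : ℝ
  Spp : ℝ → Matrix (Fin 3) (Fin 3) ℝ
  Spm : ℝ → Fin 3 → ℝ
  Smp : ℝ → Fin 3 → ℝ
  Q : Fin 3 → ℝ
  R : Fin 3 → ℝ
  L_pos : 0 < L
  lam_pos : ∀ i, 0 < lam i
  lamMinus_pos : 0 < lamMinus
  Spp_cont : ∀ i j, ContinuousOn (fun x => Spp x i j) (Icc 0 L)
  Spm_cont : ∀ i, ContinuousOn (fun x => Spm x i) (Icc 0 L)
  Smp_cont : ∀ i, ContinuousOn (fun x => Smp x i) (Icc 0 L)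

/-- The design parameters of the Lyapunov functional and of the triggering mechanism. -/
structure Design where
  A : Fin 3 → ℝ
  B : ℝ
  μ : ℝ
  σ : ℝ
  ζ : ℝ
  η : ℝ
  ς : Fin 3 → ℝ
  ς₄ : ℝ

/-- The spatial profile `(a, b)` (three components and one component) is in `L²((0,L); ℝ⁴)`. -/
def InL2 (L : ℝ) (a : ℝ → Fin 3 → ℝ) (b : ℝ → ℝ) : Prop :=
  (∀ i, MemLp (fun x => a x i) 2 (volume.restrict (Ioc 0 L))) ∧
    MemLp b 2 (volume.restrict (Ioc 0 L))

/-- The squared norm of a profile in `L²((0,L); ℝ⁴)`. -/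
def normSq (L : ℝ) (a : ℝ → Fin 3 → ℝ) (b : ℝ → ℝ) : ℝ :=
  ∫ x in (0 : ℝ)..L, ((∑ i, a x i ^ 2) + b x ^ 2)

/-- The triangle `{(x, ξ) : 0 ≤ ξ ≤ x ≤ L}`. -/
def triangle (L : ℝ) : Set (ℝ × ℝ) := {p | 0 ≤ p.2 ∧ p.2 ≤ p.1 ∧ p.1 ≤ L}

/-- The Volterra term `∫₀ˣ (G(x,ξ) a(ξ) + H(x,ξ) b(ξ)) dξ` with kernels
`G = (G₁, G₂, G₃)` and `H`. -/
def volterra (G : Fin 3 → ℝ × ℝ → ℝ) (H : ℝ × ℝ → ℝ)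
    (a : ℝ → Fin 3 → ℝ) (b : ℝ → ℝ) (x : ℝ) : ℝ :=
  ∫ ξ in (0 : ℝ)..x, ((∑ i, G i (x, ξ) * a ξ i) + H (x, ξ) * b ξ)

/-- The last component `β` of the backstepping transformation of `w = (a, b)`; the first three
components are unchanged, `α = w⁺ = a`. -/
def backstep (K : Fin 3 → ℝ × ℝ → ℝ) (M : ℝ × ℝ → ℝ)
    (a : ℝ → Fin 3 → ℝ) (b : ℝ → ℝ) (x : ℝ) : ℝ :=
  b x - volterra K M a b x

/-- The last component `w⁻` of the inverse transformation of `ϑ = (a, β)`. -/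
def invBackstep (G : Fin 3 → ℝ × ℝ → ℝ) (N : ℝ × ℝ → ℝ)
    (a : ℝ → Fin 3 → ℝ) (β : ℝ → ℝ) (x : ℝ) : ℝ :=
  β x + volterra G N a β x

/-- `(K, M)` is the classical solution on the triangle of the backstepping kernel equations
`Λ⁻ K_x - K_ξ Λ⁺ = K Σ⁺⁺(ξ) + M Σ⁻⁺(ξ)`, `Λ⁻ (M_x + M_ξ) = K Σ⁺⁻(ξ)`,
`K(x,x) (Λ⁺ + Λ⁻ I) = -Σ⁻⁺(x)`, `Λ⁻ M(x,0) = K(x,0) Λ⁺ Q`,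
which express that `β` is transported freely, `β_t - Λ⁻ β_x = 0`. -/
structure IsBacksteppingKernel (P : Plant) (K : Fin 3 → ℝ × ℝ → ℝ) (M : ℝ × ℝ → ℝ) : Prop where
  K_smooth : ∀ i, ContDiffOn ℝ 1 (K i) (triangle P.L)
  M_smooth : ContDiffOn ℝ 1 M (triangle P.L)
  K_eq : ∀ i, ∀ p ∈ triangle P.L,
    P.lamMinus * fderivWithin ℝ (K i) (triangle P.L) p (1, 0)
        - P.lam i * fderivWithin ℝ (K i) (triangle P.L) p (0, 1)
      = (∑ j, K j p * P.Spp p.2 j i) + M p * P.Smp p.2 i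
  M_eq : ∀ p ∈ triangle P.L,
    P.lamMinus * (fderivWithin ℝ M (triangle P.L) p (1, 0)
        + fderivWithin ℝ M (triangle P.L) p (0, 1))
      = ∑ j, K j p * P.Spm p.2 j
  K_diag : ∀ i, ∀ x ∈ Icc 0 P.L, K i (x, x) * (P.lam i + P.lamMinus) = - P.Smp x i
  M_bdry : ∀ x ∈ Icc 0 P.L, P.lamMinus * M (x, 0) = ∑ i, K i (x, 0) * P.lam i * P.Q i

/-- `(G, N)` are the (continuous) kernels of the inverse of the backstepping transformation with
kernels `(K, M)`. -/
structure IsInverseKernel (P : Plant) (K : Fin 3 → ℝ × ℝ → ℝ) (M : ℝ × ℝ → ℝ)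
    (G : Fin 3 → ℝ × ℝ → ℝ) (N : ℝ × ℝ → ℝ) : Prop where
  G_cont : ∀ i, ContinuousOn (G i) (triangle P.L)
  N_cont : ContinuousOn N (triangle P.L)
  left_inv : ∀ a b, InL2 P.L a b → ∀ x ∈ Icc 0 P.L,
    invBackstep G N a (backstep K M a b) x = b x
  right_inv : ∀ a β, InL2 P.L a β → ∀ x ∈ Icc 0 P.L,
    backstep K M a (invBackstep G N a β) x = β x

/-- The continuous-time backstepping feedback evaluated at the profile `w = (a, b)`:
`∫₀ᴸ (G(L,ξ) α(ξ) + N(L,ξ) β(ξ)) dξ - R w⁺(L)`. -/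
def feedback (P : Plant) (K : Fin 3 → ℝ × ℝ → ℝ) (M : ℝ × ℝ → ℝ)
    (G : Fin 3 → ℝ × ℝ → ℝ) (N : ℝ × ℝ → ℝ) (a : ℝ → Fin 3 → ℝ) (b : ℝ → ℝ) : ℝ :=
  volterra G N a (backstep K M a b) P.L - ∑ i, P.R i * a P.L i

/-- The Lyapunov functional `V` at the target profile `ϑ = (α, β)`. -/
def lyapunov (P : Plant) (D : Design) (α : ℝ → Fin 3 → ℝ) (β : ℝ → ℝ) : ℝ :=
  ∫ x in (0 : ℝ)..P.L,
    ((∑ i, D.A i / P.lam i * Real.exp (-(D.μ * x / P.lam i)) * α x i ^ 2)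
      + D.B / P.lamMinus * Real.exp (D.μ * x / P.lamMinus) * β x ^ 2)

/-- The triggering inequality `ζ B e^{μL/Λ⁻} d² ≥ ζ μ σ V - m`. -/
def Triggered (P : Plant) (D : Design) (d V m : ℝ) : Prop :=
  D.ζ * D.B * Real.exp (D.μ * P.L / P.lamMinus) * d ^ 2 ≥ D.ζ * D.μ * D.σ * V - m

/-- The right-hand side of the differential equation for `m`. -/
def mRate (P : Plant) (D : Design) (m d V : ℝ) (αL : Fin 3 → ℝ) (β0 : ℝ) : ℝ :=
  - D.η * m + D.B * Real.exp (D.μ * P.L / P.lamMinus) * d ^ 2 - D.σ * D.μ * V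
    - (∑ i, D.ς i * αL i ^ 2) - D.ς₄ * β0 ^ 2

/-- The time domain `[0, T)`, with `T = ∞` allowed. -/
def timeDomain (T : EReal) : Set ℝ := {t | 0 ≤ t ∧ (t : EReal) < T}

/-- `(u, v)`, written `u t x = w⁺(x,t)` and `v t x = w⁻(x,t)`, is an `L²` solution on `[0, T)`,
in the sense of characteristics, of the system with boundary input `U`: it is continuous in time
with values in `L²`, has boundary traces locally in `L²`, satisfies the boundary conditions, and
along almost every characteristic line each component is the integral of its source term. -/
structure IsSolution (P : Plant) (T : EReal) (U : ℝ → ℝ)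
    (u : ℝ → ℝ → Fin 3 → ℝ) (v : ℝ → ℝ → ℝ) : Prop where
  meas_u : ∀ i, Measurable (fun p : ℝ × ℝ => u p.1 p.2 i)
  meas_v : Measurable (fun p : ℝ × ℝ => v p.1 p.2)
  inL2 : ∀ t ∈ timeDomain T, InL2 P.L (u t) (v t)
  cont : ∀ t₀ ∈ timeDomain T,
    Tendsto (fun t => normSq P.L (u t - u t₀) (v t - v t₀)) (𝓝[timeDomain T] t₀) (𝓝 0)
  trace : ∀ t ∈ timeDomain T,
    (∀ i, IntervalIntegrable (fun s => u s 0 i ^ 2) volume 0 t ∧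
      IntervalIntegrable (fun s => u s P.L i ^ 2) volume 0 t) ∧
    IntervalIntegrable (fun s => v s 0 ^ 2) volume 0 t ∧
    IntervalIntegrable (fun s => v s P.L ^ 2) volume 0 t
  char_u : ∀ i, ∀ᵐ c : ℝ, ∀ s ∈ timeDomain T, ∀ t ∈ timeDomain T, s ≤ t →
    c + P.lam i * s ∈ Icc 0 P.L → c + P.lam i * t ∈ Icc 0 P.L →
    IntervalIntegrable (fun r => (∑ j, P.Spp (c + P.lam i * r) i j * u r (c + P.lam i * r) j)
        + P.Spm (c + P.lam i * r) i * v r (c + P.lam i * r)) volume s t ∧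
    u t (c + P.lam i * t) i = u s (c + P.lam i * s) i +
      ∫ r in s..t, ((∑ j, P.Spp (c + P.lam i * r) i j * u r (c + P.lam i * r) j)
        + P.Spm (c + P.lam i * r) i * v r (c + P.lam i * r))
  char_v : ∀ᵐ c : ℝ, ∀ s ∈ timeDomain T, ∀ t ∈ timeDomain T, s ≤ t →
    c - P.lamMinus * s ∈ Icc 0 P.L → c - P.lamMinus * t ∈ Icc 0 P.L →
    IntervalIntegrable (fun r => ∑ j, P.Smp (c - P.lamMinus * r) j * u r (c - P.lamMinus * r) j)
      volume s t ∧
    v t (c - P.lamMinus * t) = v s (c - P.lamMinus * s) +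
      ∫ r in s..t, ∑ j, P.Smp (c - P.lamMinus * r) j * u r (c - P.lamMinus * r) j
  bdry_zero : ∀ t ∈ timeDomain T, ∀ i, u t 0 i = P.Q i * v t 0
  bdry_L : ∀ t ∈ timeDomain T, v t P.L = (∑ i, P.R i * u t P.L i) + U t

/-- The closed loop under the event-triggered feedback. The data are the state `(u, v)`, the
applied input `Ud`, the auxiliary variable `m` and the execution times `tk` (`tk k = ⊤` if there
are at most `k - 1` events after time `0`). The closed loop lives on `[0, T)`, where
`T = sup_k tk k`, so that `T = ∞` unless the execution times accumulate. -/
structure IsClosedLoop (P : Plant) (D : Design) (K : Fin 3 → ℝ × ℝ → ℝ) (M : ℝ × ℝ → ℝ)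
    (G : Fin 3 → ℝ × ℝ → ℝ) (N : ℝ × ℝ → ℝ)
    (u : ℝ → ℝ → Fin 3 → ℝ) (v : ℝ → ℝ → ℝ) (Ud m : ℝ → ℝ) (tk : ℕ → EReal) : Prop where
  solution : IsSolution P (⨆ k, tk k) Ud u v
  time_zero : tk 0 = 0
  /-- the feedback is sampled at `tk k` and held until `tk (k + 1)` -/
  hold : ∀ k, ∀ t : ℝ, tk k ≤ (t : EReal) → (t : EReal) < tk (k + 1) →
    Ud t = feedback P K M G N (u (tk k).toReal) (v (tk k).toReal)
  /-- the next execution time is the infimum (`⊤` for the empty set) of the later times at which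
  the input held since `tk k` violates the triggering bound -/
  next : ∀ k, tk (k + 1) = sInf ((fun t : ℝ => (t : EReal)) '' {t : ℝ | tk k < (t : EReal) ∧
    Triggered P D
      (feedback P K M G N (u (tk k).toReal) (v (tk k).toReal) - feedback P K M G N (u t) (v t))
      (lyapunov P D (u t) (backstep K M (u t) (v t))) (m t)})
  m_zero : m 0 < 0
  m_eq : ∀ t ∈ timeDomain (⨆ k, tk k),
    IntervalIntegrable (fun s => mRate P D (m s) (Ud s - feedback P K M G N (u s) (v s))
      (lyapunov P D (u s) (backstep K M (u s) (v s))) (u s P.L)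
      (backstep K M (u s) (v s) 0)) volume 0 t ∧
    m t = m 0 + ∫ s in (0 : ℝ)..t,
      mRate P D (m s) (Ud s - feedback P K M G N (u s) (v s))
        (lyapunov P D (u s) (backstep K M (u s) (v s))) (u s P.L)
        (backstep K M (u s) (v s) 0)

/-- `max_{x ∈ [0,L]} ‖Σ⁺⁺(x)‖`, spectral norm. -/
def supSpp (P : Plant) : ℝ :=
  sSup ((fun x => ‖Matrix.toEuclideanCLM (𝕜 := ℝ) (P.Spp x)‖) '' Icc 0 P.L)

/-- `max_{x ∈ [0,L]} ‖Σ⁺⁻(x)‖`, Euclidean norm. -/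
def supSpm (P : Plant) : ℝ :=
  sSup ((fun x => ‖WithLp.toLp 2 (P.Spm x)‖) '' Icc 0 P.L)

/-- The constant `γ = 2 A / (p₃ min λ_i) (max ‖Σ⁺⁺‖ + (1 + 1/p₁) max ‖Σ⁺⁻‖)`, `A = max A_i`. -/
def gammaConst (P : Plant) (D : Design) (p₁ p₃ : ℝ) : ℝ :=
  2 * (⨆ i, D.A i) / (p₃ * ⨅ i, P.lam i) * (supSpp P + (1 + 1 / p₁) * supSpm P)

/-- The rate `μ (1 - σ) - γ`. -/
def decayRate (P : Plant) (D : Design) (p₁ p₃ : ℝ) : ℝ :=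
  D.μ * (1 - D.σ) - gammaConst P D p₁ p₃

/-- `p₁ ‖w‖² ≤ ‖ϑ‖² ≤ p₂ ‖w‖²` for all `w` in `L²`, `ϑ` being the transform of `w`. -/
def TransformBounds (P : Plant) (K : Fin 3 → ℝ × ℝ → ℝ) (M : ℝ × ℝ → ℝ) (p₁ p₂ : ℝ) : Prop :=
  ∀ a b, InL2 P.L a b →
    p₁ * normSq P.L a b ≤ normSq P.L a (backstep K M a b) ∧
      normSq P.L a (backstep K M a b) ≤ p₂ * normSq P.L a b

/-- `p₃ ‖ϑ‖² ≤ V ≤ p₄ ‖ϑ‖²` for all `ϑ` in `L²`. -/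
def LyapunovBounds (P : Plant) (D : Design) (p₃ p₄ : ℝ) : Prop :=
  ∀ α β, InL2 P.L α β →
    p₃ * normSq P.L α β ≤ lyapunov P D α β ∧ lyapunov P D α β ≤ p₄ * normSq P.L α β

/-- Exponential convergence to zero on `[0, T)` in the `L²` norm at the rate `κ`. -/
def ExpConverges (L : ℝ) (κ : ℝ) (T : EReal) (u : ℝ → ℝ → Fin 3 → ℝ) (v : ℝ → ℝ → ℝ) : Prop :=
  ∃ C : ℝ, ∀ t ∈ timeDomain T, Real.sqrt (normSq L (u t) (v t)) ≤ C * Real.exp (-(κ * t))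

end MixedTraffic

end

/-! The Lyapunov function is `V - m`. The kernel equations make `β` a freely transported quantity,
and at `x = L` the boundary condition and the inverse transformation give `β(L) = d`. Formally,
differentiating `V` gives `-μ V`, the boundary terms `B e^{μL/Λ⁻} d² + (∑ A_i q_i² - B) β(0)² - ∑
A_i e^{-μL/λ_i} α_i(L)²`, and the contribution of the sources of `α`, which is at most `γ V`.
Subtracting the equation for `m` cancels the `d²` term exactly, the conditions on `ς` absorb the
traces, and what remains is at most `-c V + η m`. If `m < 0`, this is at most `-κ (V - m)` for every
`κ ≤ min c η`. Grönwall's inequality and the norm equivalences finish the proof.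

The sign of `m` comes from the trigger. Between execution times it does not hold, so `B e^{μL/Λ⁻} d²
≤ σ μ V - m / ζ` and hence `m' ≤ -(η + 1/ζ) m`. The execution times are countable and play no role
in an integrated inequality (`IsClosedLoop.m_neg`, `IsClosedLoop.lyapunov_sub_m_le`).

Solutions are only `L²`, so no partial derivative of the state exists and each differentiation is
replaced by an integrated balance. The source of all of them is `transport_balance`: a quantity with
an integral equation along almost every line of slope `κ` satisfies the divergence theorem on a
trapezoid whose right end moves with speed `-ω`. With `ω = 0` it gives the energy identity behind
`IsSolution.lyapunov_balance`. With `ω = Λ⁻`, so that the right end follows a leftgoing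
characteristic, it differentiates the Volterra term along that characteristic and shows that `β` is
constant there (`IsSolution.backstep_const`). -/

noncomputable section

namespace MixedTraffic

/-! ### Calculus of indefinite integrals: product rule and Grönwall's inequality -/

/-- `g` is on `[s, t]` an indefinite integral of the integrable function `f`. -/
def IsPrimitive (g f : ℝ → ℝ) (s t : ℝ) : Prop :=
  IntervalIntegrable f volume s t ∧ ∀ r ∈ Icc s t, g r = g s + ∫ x in s..r, f x

namespace IsPrimitive

variable {g f g₁ f₁ g₂ f₂ : ℝ → ℝ} {s t s' t' : ℝ}

theorem integral_eq (h : IsPrimitive g f s t) (hst : s ≤ t) : g t = g s + ∫ x in s..t, f x :=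
  h.2 t (right_mem_Icc.2 hst)

theorem mono (h : IsPrimitive g f s t) (h₁ : s ≤ s') (h₂ : s' ≤ t') (h₃ : t' ≤ t) :
    IsPrimitive g f s' t' := by
  have hint : ∀ a ∈ Icc s t, ∀ b ∈ Icc s t, IntervalIntegrable f volume a b := fun a ha b hb =>
    h.1.mono_set (by
      rw [uIcc_of_le (h₁.trans (h₂.trans h₃))]
      exact uIcc_subset_Icc ha hb)
  have hs' : s' ∈ Icc s t := ⟨h₁, h₂.trans h₃⟩
  have ht' : t' ∈ Icc s t := ⟨h₁.trans h₂, h₃⟩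
  refine ⟨hint _ hs' _ ht', fun r hr => ?_⟩
  have hr' : r ∈ Icc s t := ⟨h₁.trans hr.1, hr.2.trans h₃⟩
  rw [h.2 r hr', h.2 s' hs', add_assoc, intervalIntegral.integral_add_adjacent_intervals
    (hint _ (left_mem_Icc.2 (h₁.trans (h₂.trans h₃))) _ hs') (hint _ hs' _ hr')]

theorem congr (h : IsPrimitive g₁ f₁ s t) (hst : s ≤ t) (hg : ∀ r ∈ Icc s t, g₁ r = g₂ r)
    (hf : ∀ r ∈ Icc s t, f₁ r = f₂ r) : IsPrimitive g₂ f₂ s t := by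
  have hf' : ∀ r ∈ Icc s t, EqOn f₁ f₂ (uIcc s r) := fun r hr x hx => by
    rw [uIcc_of_le hr.1] at hx
    exact hf x ⟨hx.1, hx.2.trans hr.2⟩
  refine ⟨h.1.congr ?_, fun r hr => ?_⟩
  · intro x hx
    exact hf' t (right_mem_Icc.2 hst) (uIoc_subset_uIcc hx)
  · rw [← hg r hr, ← hg s (left_mem_Icc.2 hst), h.2 r hr,
      intervalIntegral.integral_congr (hf' r hr)]

theorem const (c s t : ℝ) : IsPrimitive (fun _ => c) (fun _ => 0) s t :=
  ⟨intervalIntegrable_const, fun r _ => by simp⟩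

theorem continuousOn (h : IsPrimitive g f s t) (hst : s ≤ t) : ContinuousOn g (Icc s t) := by
  have := intervalIntegral.continuousOn_primitive_interval'
    h.1 (left_mem_uIcc)
  rw [uIcc_of_le hst] at this
  exact (continuousOn_const.add this).congr fun r hr => h.2 r hr

theorem add (h₁ : IsPrimitive g₁ f₁ s t) (h₂ : IsPrimitive g₂ f₂ s t) :
    IsPrimitive (fun r => g₁ r + g₂ r) (fun r => f₁ r + f₂ r) s t := by
  refine ⟨h₁.1.add h₂.1, fun r hr => ?_⟩
  have hsub : uIcc s r ⊆ uIcc s t := by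
    rw [uIcc_of_le hr.1, uIcc_of_le (hr.1.trans hr.2)]
    exact Icc_subset_Icc_right hr.2
  rw [intervalIntegral.integral_add (h₁.1.mono_set hsub) (h₂.1.mono_set hsub)]
  linear_combination h₁.2 r hr + h₂.2 r hr

theorem const_mul (h : IsPrimitive g f s t) (c : ℝ) :
    IsPrimitive (fun r => c * g r) (fun r => c * f r) s t :=
  ⟨h.1.const_mul c, fun r hr => by
    rw [intervalIntegral.integral_const_mul]
    linear_combination c * h.2 r hr⟩

theorem of_hasDerivWithinAt (hst : s ≤ t) (hf : ContinuousOn f (Icc s t))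
    (hd : ∀ r ∈ Icc s t, HasDerivWithinAt g (f r) (Icc s t) r) : IsPrimitive g f s t := by
  refine ⟨(uIcc_of_le hst ▸ hf).intervalIntegrable, fun r hr => ?_⟩
  have hsub : Icc s r ⊆ Icc s t := Icc_subset_Icc_right hr.2
  rw [intervalIntegral.integral_eq_sub_of_hasDerivAt_of_le hr.1
    (fun x hx => ((hd x (hsub hx)).continuousWithinAt).mono hsub)
    (fun x hx => (hd x (hsub (Ioo_subset_Icc_self hx))).hasDerivAt
      (Icc_mem_nhds hx.1 (hx.2.trans_le hr.2)))
    ((uIcc_of_le hr.1 ▸ hf.mono hsub).intervalIntegrable)]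
  ring

/-- Integration by parts for absolutely continuous functions. Nothing is known of `g₁` and `g₂` off
`[s, t]`, so it is applied to the explicit primitives `g s + ∫ f`, whose derivatives are `f` almost
everywhere by Lebesgue's theorem. -/
theorem mul (h₁ : IsPrimitive g₁ f₁ s t) (h₂ : IsPrimitive g₂ f₂ s t) (hst : s ≤ t) :
    IsPrimitive (fun r => g₁ r * g₂ r) (fun r => f₁ r * g₂ r + g₁ r * f₂ r) s t := by
  have hc₁ : ContinuousOn g₁ (uIcc s t) := uIcc_of_le hst ▸ h₁.continuousOn hst
  have hc₂ : ContinuousOn g₂ (uIcc s t) := uIcc_of_le hst ▸ h₂.continuousOn hst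
  have key : ∀ r ∈ Icc s t, g₁ r * g₂ r = g₁ s * g₂ s +
      ∫ x in s..r, (f₁ x * g₂ x + g₁ x * f₂ x) := by
    intro r hr
    have p₁ := h₁.mono le_rfl hr.1 hr.2
    have p₂ := h₂.mono le_rfl hr.1 hr.2
    have ac : ∀ {g f : ℝ → ℝ}, IsPrimitive g f s r →
        AbsolutelyContinuousOnInterval (fun x => g s + ∫ y in s..x, f y) s r := fun h =>
      ((LipschitzWith.const _).lipschitzOnWith.absolutelyContinuousOnInterval
        (K := 0)).fun_add
        (h.1.absolutelyContinuousOnInterval_intervalIntegral left_mem_uIcc)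
    have dv : ∀ {g f : ℝ → ℝ}, IsPrimitive g f s r → ∀ᵐ x, x ∈ uIcc s r →
        deriv (fun x => g s + ∫ y in s..x, f y) x = f x := fun h => by
      filter_upwards [h.1.ae_hasDerivAt_integral] with x hx hxm
      exact ((hx hxm s left_mem_uIcc).const_add _).deriv
    have := (ac p₁).integral_deriv_mul_eq_sub (ac p₂)
    simp only [intervalIntegral.integral_same, add_zero] at this
    rw [← p₁.2 r (right_mem_Icc.2 hr.1), ← p₂.2 r (right_mem_Icc.2 hr.1)] at this
    rw [← sub_eq_iff_eq_add', ← this]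
    apply intervalIntegral.integral_congr_ae
    filter_upwards [dv p₁, dv p₂] with x hx₁ hx₂ hx
    have hx' := uIoc_subset_uIcc hx
    have hx'' : x ∈ Icc s r := by rwa [uIcc_of_le hr.1] at hx'
    rw [hx₁ hx', hx₂ hx', ← p₁.2 x hx'', ← p₂.2 x hx'']
  exact ⟨(h₁.1.mul_continuousOn hc₂).add (h₂.1.continuousOn_mul hc₁), key⟩

/-- Grönwall's inequality for indefinite integrals. -/
theorem le_exp_mul (h : IsPrimitive g f s t) (hst : s ≤ t) {κ : ℝ}
    (hle : ∀ᵐ r, r ∈ Ioc s t → f r ≤ -κ * g r) : g t ≤ Real.exp (-κ * (t - s)) * g s := by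
  have he : IsPrimitive (fun r => Real.exp (κ * (r - s))) (fun r => Real.exp (κ * (r - s)) * κ)
      s t := by
    refine of_hasDerivWithinAt hst (by fun_prop) fun r _ => ?_
    have : HasDerivAt (fun r => κ * (r - s)) κ r := by
      simpa using ((hasDerivAt_id r).sub_const s).const_mul κ
    exact this.exp.hasDerivWithinAt
  have hm := (he.mul h hst).integral_eq hst
  have hle' : ∫ x in s..t, (Real.exp (κ * (x - s)) * κ * g x + Real.exp (κ * (x - s)) * f x)
      ≤ 0 := by
    rw [intervalIntegral.integral_of_le hst]
    refine integral_nonpos_of_ae ?_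
    rw [EventuallyLE, ae_restrict_iff' measurableSet_Ioc]
    filter_upwards [hle] with r hr hrm
    have := hr hrm
    have hp := Real.exp_pos (κ * (r - s))
    simp only [Pi.zero_apply]
    nlinarith
  simp only [sub_self, mul_zero, Real.exp_zero, one_mul] at hm
  have h1 : Real.exp (κ * (t - s)) * g t ≤ g s := by linarith
  calc g t = Real.exp (-κ * (t - s)) * (Real.exp (κ * (t - s)) * g t) := by
        rw [← mul_assoc, ← Real.exp_add]; simp
    _ ≤ _ := mul_le_mul_of_nonneg_left h1 (Real.exp_pos _).le

end IsPrimitive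

/-! ### Divergence theorem along characteristics -/

theorem intervalIntegrable_comp_affine {h : ℝ → ℝ} {c d a b : ℝ} (hc : c ≠ 0)
    (hh : IntervalIntegrable h volume (c * a + d) (c * b + d)) :
    IntervalIntegrable (fun x => h (c * x + d)) volume a b := by
  have h1 := (hh.comp_add_right d).comp_mul_left (c := c)
  simpa [hc, mul_div_cancel_left₀] using h1

theorem integrable_indicator_Ioc {h : ℝ → ℝ} {a b : ℝ} (hab : a ≤ b)
    (hh : IntervalIntegrable h volume a b) :
    Integrable ((Ioc a b).indicator h) ∧ ∫ x, (Ioc a b).indicator h x = ∫ x in a..b, h x := by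
  rw [intervalIntegrable_iff_integrableOn_Ioc_of_le hab] at hh
  exact ⟨hh.integrable_indicator measurableSet_Ioc, by
    rw [integral_indicator measurableSet_Ioc, intervalIntegral.integral_of_le hab]⟩

/-- In the coordinates `(r, b)` with `x = b + κ r`, the number `b` labels the characteristics of
speed `κ`. Fubini's theorem in these coordinates slices a space-time set into characteristic
segments. -/
theorem measurePreserving_shear (κ : ℝ) :
    MeasurePreserving (fun p : ℝ × ℝ => (p.1, p.2 + κ * p.1)) volume volume := by
  have := (MeasurePreserving.id (volume : Measure ℝ)).skew_product (μc := volume) (μd := volume)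
    (g := fun r b => b + κ * r) (by fun_prop)
    (ae_of_all _ fun r => (measurePreserving_add_right volume (κ * r)).map_eq)
  simpa [Measure.volume_eq_prod] using this

theorem measurableEmbedding_shear (κ : ℝ) :
    MeasurableEmbedding (fun p : ℝ × ℝ => (p.1, p.2 + κ * p.1)) := by
  refine MeasurableEmbedding.of_measurable_inverse (g := fun p => (p.1, p.2 - κ * p.1))
    (by fun_prop) ?_ (by fun_prop) fun p => by simp
  convert MeasurableSet.univ
  exact range_eq_univ.2 fun p => ⟨(p.1, p.2 - κ * p.1), by simp⟩

/-- The trapezoid swept in the time interval `(s, t]` by the space interval `(0, e - ω r]`. -/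
def trapezoid (e ω s t : ℝ) : Set (ℝ × ℝ) := {p | p.1 ∈ Ioc s t ∧ p.2 ∈ Ioc 0 (e - ω * p.1)}

theorem measurableSet_trapezoid (e ω s t : ℝ) : MeasurableSet (trapezoid e ω s t) := by
  refine (measurableSet_Ioc.preimage measurable_fst).inter
    ((measurableSet_lt measurable_const measurable_snd).inter
    (measurableSet_le measurable_snd ?_))
  fun_prop

/-- Almost every line of slope `κ` meets the domain of an integrable function in an integrable
way. -/
theorem ae_integrable_line {F : ℝ → ℝ → ℝ} {S : Set (ℝ × ℝ)} (hS : MeasurableSet S)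
    (hF : IntegrableOn (fun p => F p.1 p.2) S) (κ : ℝ) :
    ∀ᵐ b : ℝ, IntegrableOn (fun r => F r (b + κ * r)) {r | (r, b + κ * r) ∈ S} := by
  have h1 : Integrable (S.indicator fun p : ℝ × ℝ => F p.1 p.2) := hF.integrable_indicator hS
  have h2 := ((measurePreserving_shear κ).integrable_comp_emb (measurableEmbedding_shear κ)).2 h1
  rw [Measure.volume_eq_prod] at h2
  filter_upwards [h2.prod_left_ae] with b hb
  have hm : MeasurableSet {r : ℝ | (r, b + κ * r) ∈ S} := by
    have : Measurable fun r : ℝ => (r, b + κ * r) := by fun_prop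
    exact this hS
  rw [← integrable_indicator_iff hm]
  refine hb.congr (ae_of_all _ fun r => ?_)
  by_cases hr : (r, b + κ * r) ∈ S <;> simp [indicator, hr]

theorem integral_balance {E₁ E₂ E₃ E₄ J : ℝ → ℝ} (h₁ : Integrable E₁) (h₂ : Integrable E₂)
    (h₃ : Integrable E₃) (h₄ : Integrable E₄) (hJ : Integrable J)
    (h : ∀ᵐ b, E₁ b - E₄ b = E₃ b - E₂ b + J b) :
    (∫ b, E₁ b) - ∫ b, E₄ b = (∫ b, E₃ b) - (∫ b, E₂ b) + ∫ b, J b := by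
  rw [← integral_sub h₁ h₄, ← integral_sub h₃ h₂,
    ← integral_add (f := fun b => E₃ b - E₂ b) (h₃.sub h₂) hJ]
  exact integral_congr_ae h

/-- A line of slope `κ` meets the trapezoid in at most one segment, entering through the initial
slice or through `x = 0` and leaving through the final slice or the moving right end. Along it `Y`
grows by the integral of `F`. Integrating over the label `b` of the line gives the identity: the
factors `κ` and `κ + ω` are the Jacobians between `b` and the time at which the line crosses `x = 0`
or the right end. -/
theorem transport_balance_of_pos {κ ω e s t : ℝ} (hκ : 0 < κ) (hω : 0 ≤ κ + ω) (hst : s ≤ t)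
    (hes : 0 ≤ e - ω * s) (het : 0 ≤ e - ω * t) {Y F : ℝ → ℝ → ℝ}
    (hF : IntegrableOn (fun p => F p.1 p.2) (trapezoid e ω s t))
    (hYs : IntervalIntegrable (Y s) volume 0 (e - ω * s))
    (hYt : IntervalIntegrable (Y t) volume 0 (e - ω * t))
    (h0 : IntervalIntegrable (fun r => Y r 0) volume s t)
    (h1 : κ + ω ≠ 0 → IntervalIntegrable (fun r => Y r (e - ω * r)) volume s t)
    (hchar : ∀ᵐ b : ℝ, ∀ s' t', s ≤ s' → s' ≤ t' → t' ≤ t → b + κ * s' ∈ Icc 0 (e - ω * s') →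
      b + κ * t' ∈ Icc 0 (e - ω * t') →
      Y t' (b + κ * t') = Y s' (b + κ * s') + ∫ r in s'..t', F r (b + κ * r)) :
    (∫ x in (0 : ℝ)..(e - ω * t), Y t x) - ∫ x in (0 : ℝ)..(e - ω * s), Y s x =
      κ * (∫ r in s..t, Y r 0) - (κ + ω) * (∫ r in s..t, Y r (e - ω * r))
        + ∫ p in trapezoid e ω s t, F p.1 p.2 := by
  set k := κ + ω with hk
  set D := trapezoid e ω s t with hD
  have hDm : MeasurableSet D := measurableSet_trapezoid _ _ _ _
  have i1 : Integrable (D.indicator fun p : ℝ × ℝ => F p.1 p.2) := hF.integrable_indicator hDm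
  have i2 := ((measurePreserving_shear κ).integrable_comp_emb (measurableEmbedding_shear κ)).2 i1
  have e1 : ∫ p in D, F p.1 p.2 =
      ∫ b, ∫ r, D.indicator (fun p : ℝ × ℝ => F p.1 p.2) (r, b + κ * r) := by
    rw [← integral_indicator hDm, ← (measurePreserving_shear κ).integral_comp
      (measurableEmbedding_shear κ)]
    rw [Measure.volume_eq_prod] at i2 ⊢
    exact integral_prod_symm _ i2
  -- the four boundary contributions, as functions of the label of the line
  have hb0 : -κ * t ≤ e - k * t := by rw [hk]; linarith
  have hb1 : e - k * t ≤ e - k * s := by nlinarith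
  have hb2 : -κ * t ≤ -κ * s := by nlinarith
  have hb3 : -κ * s ≤ e - k * s := by rw [hk]; linarith
  obtain ⟨j1, v1⟩ := integrable_indicator_Ioc hb0 (h := fun b => Y t (1 * b + κ * t))
    (intervalIntegrable_comp_affine one_ne_zero
      (by convert hYt using 1 <;> (try rw [hk]) <;> ring))
  obtain ⟨j2, v2⟩ : Integrable ((Ioc (e - k * t) (e - k * s)).indicator
        fun b => Y ((-1 / k) * b + e / k) (e - ω * ((-1 / k) * b + e / k))) ∧
      ∫ b, (Ioc (e - k * t) (e - k * s)).indicator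
        (fun b => Y ((-1 / k) * b + e / k) (e - ω * ((-1 / k) * b + e / k))) b =
        k * ∫ r in s..t, Y r (e - ω * r) := by
    rcases eq_or_ne k 0 with h | h
    -- Here the right end is itself a characteristic, so nothing crosses it and no trace there is
    -- needed.
    · simp [h]
    · have hc : (-1 / k) ≠ 0 := by simp [h]
      have l1 : (-1 / k) * (e - k * t) + e / k = t := by field_simp; ring
      have l2 : (-1 / k) * (e - k * s) + e / k = s := by field_simp; ring
      obtain ⟨j, v⟩ := integrable_indicator_Ioc hb1
        (intervalIntegrable_comp_affine (h := fun r => Y r (e - ω * r)) (c := -1 / k)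
          (d := e / k) hc (by rw [l1, l2]; exact (h1 h).symm))
      refine ⟨j, ?_⟩
      rw [v, intervalIntegral.integral_comp_mul_add (fun r => Y r (e - ω * r)) hc, l1, l2,
        intervalIntegral.integral_symm s t]
      simp [div_neg]
  obtain ⟨j3, v3⟩ : Integrable ((Ioc (-κ * t) (-κ * s)).indicator
        fun b => Y ((-1 / κ) * b + 0) 0) ∧
      ∫ b, (Ioc (-κ * t) (-κ * s)).indicator (fun b => Y ((-1 / κ) * b + 0) 0) b =
        κ * ∫ r in s..t, Y r 0 := by
    have hc : (-1 / κ) ≠ 0 := by simp [hκ.ne']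
    have l1 : (-1 / κ) * (-κ * t) + 0 = t := by field_simp; ring
    have l2 : (-1 / κ) * (-κ * s) + 0 = s := by field_simp; ring
    obtain ⟨j, v⟩ := integrable_indicator_Ioc hb2
      (intervalIntegrable_comp_affine (h := fun r => Y r 0) (c := -1 / κ)
        (d := 0) hc (by rw [l1, l2]; exact h0.symm))
    refine ⟨j, ?_⟩
    rw [v, intervalIntegral.integral_comp_mul_add (fun r => Y r 0) hc, l1, l2,
      intervalIntegral.integral_symm s t]
    simp [div_neg]
  obtain ⟨j4, v4⟩ := integrable_indicator_Ioc hb3 (h := fun b => Y s (1 * b + κ * s))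
    (intervalIntegrable_comp_affine one_ne_zero
      (by convert hYs using 1 <;> (try rw [hk]) <;> ring))
  rw [intervalIntegral.integral_comp_mul_add _ one_ne_zero] at v1 v4
  rw [show 1 * (-κ * t) + κ * t = 0 by ring,
    show 1 * (e - k * t) + κ * t = e - ω * t by rw [hk]; ring] at v1
  rw [show 1 * (-κ * s) + κ * s = 0 by ring,
    show 1 * (e - k * s) + κ * s = e - ω * s by rw [hk]; ring] at v4
  simp only [inv_one, one_smul] at v1 v4
  rw [← v1, ← v2, ← v3, ← v4, e1]
  have j5 : Integrable fun b => ∫ r, D.indicator (fun p : ℝ × ℝ => F p.1 p.2) (r, b + κ * r) := by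
    rw [Measure.volume_eq_prod] at i2
    exact i2.integral_prod_right
  refine integral_balance j1 j2 j3 j4 j5 ?_
  filter_upwards [hchar] with b hb
  have sec : ∀ a n, s ≤ a → a ≤ n → n ≤ t → b + κ * a ∈ Icc 0 (e - ω * a) →
      b + κ * n ∈ Icc 0 (e - ω * n) →
      (∀ r, (r, b + κ * r) ∈ D ↔ r ∈ Ioc a n) →
      ∫ r, D.indicator (fun p : ℝ × ℝ => F p.1 p.2) (r, b + κ * r)
        = Y n (b + κ * n) - Y a (b + κ * a) := by
    intro a n h1 h2 h3 h4 h5 h6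
    rw [hb a n h1 h2 h3 h4 h5, add_sub_cancel_left, intervalIntegral.integral_of_le h2,
      ← integral_indicator measurableSet_Ioc]
    refine integral_congr_ae (ae_of_all _ fun r => ?_)
    by_cases hr : r ∈ Ioc a n
    · simp only [indicator_of_mem ((h6 r).2 hr), indicator_of_mem hr]
    · simp only [indicator_of_notMem (mt (h6 r).1 hr), indicator_of_notMem hr]
  have hmem : ∀ r, (r, b + κ * r) ∈ D ↔
      (s < r ∧ r ≤ t) ∧ 0 < b + κ * r ∧ b + κ * r ≤ e - ω * r := fun r => Iff.rfl
  have triv : (∀ r, (r, b + κ * r) ∉ D) →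
      ∫ r, D.indicator (fun p : ℝ × ℝ => F p.1 p.2) (r, b + κ * r) = 0 := fun h => by
    simp [indicator_of_notMem (h _)]
  -- Only the labels in `(-κ t, e - k s]` meet the trapezoid. The final slice and the right end
  -- share this interval between them, and so do `x = 0` and the initial slice.
  rcases le_or_gt b (-κ * t) with c1 | c1
  · rw [triv fun r hr => ?_, indicator_of_notMem (fun h => h.1.not_ge c1),
      indicator_of_notMem (fun h => h.1.not_ge (c1.trans hb2)),
      indicator_of_notMem (fun h => h.1.not_ge c1),
      indicator_of_notMem (fun h => h.1.not_ge (c1.trans hb0))]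
    · simp
    · have := (hmem r).1 hr
      nlinarith
  rcases lt_or_ge (e - k * s) b with c2 | c2
  · rw [triv fun r hr => ?_, indicator_of_notMem (fun h => c2.not_ge (h.2.trans hb1)),
      indicator_of_notMem (fun h => c2.not_ge h.2),
      indicator_of_notMem (fun h => c2.not_ge (h.2.trans hb3)),
      indicator_of_notMem (fun h => c2.not_ge h.2)]
    · simp
    · have := (hmem r).1 hr
      nlinarith
  -- The exit time: `t` if the line reaches the final slice, otherwise the time `(e - b) / k` at
  -- which it hits the right end. The two half-open label intervals are disjoint, so exactly one
  -- indicator is active.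
  obtain ⟨n, hsn, hnt, hn1, hn2, hn3⟩ : ∃ n, s ≤ n ∧ n ≤ t ∧ b + κ * n ≤ e - ω * n ∧
      (∀ r, (r ≤ t ∧ b + κ * r ≤ e - ω * r) ↔ r ≤ n) ∧
      (Ioc (-κ * t) (e - k * t)).indicator (fun b => Y t (1 * b + κ * t)) b +
      (Ioc (e - k * t) (e - k * s)).indicator
        (fun b => Y ((-1 / k) * b + e / k) (e - ω * ((-1 / k) * b + e / k))) b =
        Y n (b + κ * n) := by
    rcases le_or_gt b (e - k * t) with c3 | c3
    · refine ⟨t, hst, le_rfl, by rw [hk] at c3; linarith, fun r => ⟨fun h => h.1, fun h =>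
        ⟨h, ?_⟩⟩, ?_⟩
      · have : k * r ≤ k * t := mul_le_mul_of_nonneg_left h hω
        rw [hk] at this c3
        linarith
      · rw [indicator_of_mem (show b ∈ Ioc _ _ from ⟨c1, c3⟩),
          indicator_of_notMem (fun h => h.1.not_ge c3), one_mul, add_zero]
    · have hk0 : 0 < k := by
        rcases hω.eq_or_lt with h | h
        · rw [← h] at c2 c3
          linarith
        · exact h
      have hn : (-1 / k) * b + e / k = (e - b) / k := by ring
      have hkn : k * ((e - b) / k) = e - b := by field_simp
      have hfn : e - ω * ((e - b) / k) = b + κ * ((e - b) / k) := by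
        rw [hk] at hkn ⊢
        linarith
      refine ⟨(e - b) / k, by rw [le_div_iff₀ hk0]; linarith, by rw [div_le_iff₀ hk0]; linarith,
        hfn.ge, fun r => ?_, ?_⟩
      · rw [le_div_iff₀ hk0]
        refine ⟨fun h => by rw [hk]; linarith, fun h => ⟨?_, by rw [hk] at h; linarith⟩⟩
        nlinarith
      · rw [indicator_of_mem (show b ∈ Ioc _ _ from ⟨c3, c2⟩),
          indicator_of_notMem (fun h => c3.not_ge h.2), zero_add, hn, hfn]
  -- The entry time: `-b / κ` for a line coming in through `x = 0`, otherwise `s`.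
  obtain ⟨a, hsa, hat, ha1, ha2, ha3⟩ : ∃ a, s ≤ a ∧ a ≤ t ∧ 0 ≤ b + κ * a ∧
      (∀ r, (s < r ∧ 0 < b + κ * r) ↔ a < r) ∧
      (Ioc (-κ * t) (-κ * s)).indicator (fun b => Y ((-1 / κ) * b + 0) 0) b +
      (Ioc (-κ * s) (e - k * s)).indicator (fun b => Y s (1 * b + κ * s)) b =
        Y a (b + κ * a) := by
    rcases le_or_gt b (-κ * s) with c3 | c3
    · have hn : (-1 / κ) * b + 0 = -b / κ := by ring
      have hkn : κ * (-b / κ) = -b := by field_simp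
      refine ⟨-b / κ, by rw [le_div_iff₀ hκ]; linarith, by rw [div_le_iff₀ hκ]; linarith,
        by rw [hkn]; simp, fun r => ?_, ?_⟩
      · rw [div_lt_iff₀ hκ]
        refine ⟨fun h => by linarith, fun h => ⟨?_, by linarith⟩⟩
        nlinarith
      · rw [indicator_of_mem (show b ∈ Ioc _ _ from ⟨c1, c3⟩),
          indicator_of_notMem (fun h => h.1.not_ge c3), add_zero, hn, hkn, add_neg_cancel]
    · refine ⟨s, le_rfl, hst, by linarith, fun r => ⟨fun h => h.1, fun h => ⟨h, ?_⟩⟩, ?_⟩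
      · nlinarith
      · rw [indicator_of_mem (show b ∈ Ioc _ _ from ⟨c3, c2⟩),
          indicator_of_notMem (fun h => c3.not_ge h.2), one_mul, zero_add]
  -- A time strictly between exit and entry would give `e - ω r < b + κ r ≤ 0`, whereas the width `e
  -- - ω r` is affine and nonnegative at both `s` and `t`.
  have han : a ≤ n := by
    by_contra h
    push Not at h
    obtain ⟨r, hr1, hr2⟩ := exists_between h
    have h1 : ¬ (r ≤ t ∧ b + κ * r ≤ e - ω * r) := fun h' => ((hn2 r).1 h').not_gt hr1
    have h2 : ¬ (s < r ∧ 0 < b + κ * r) := fun h' => ((ha2 r).1 h').not_gt hr2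
    have h3 : b + κ * r ≤ 0 := by
      by_contra h'
      exact h2 ⟨hsn.trans_lt hr1, not_le.1 h'⟩
    have h4 : e - ω * r < b + κ * r := by
      by_contra h'
      exact h1 ⟨(hr2.trans_le hat).le, not_lt.1 h'⟩
    have hr : r ∈ Icc s t := ⟨(hsn.trans_lt hr1).le, (hr2.trans_le hat).le⟩
    rcases le_total 0 ω with hw | hw
    · nlinarith [hr.2, mul_le_mul_of_nonneg_left hr.2 hw]
    · nlinarith [hr.1, mul_le_mul_of_nonpos_left hr.1 hw]
  have hbal := sec a n hsa han hnt ⟨ha1, ((hn2 a).2 han).2⟩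
    ⟨ha1.trans (by nlinarith), hn1⟩ (fun r => by
      rw [hmem, mem_Ioc, ← ha2 r, ← hn2 r]
      tauto)
  rw [hbal, ← hn3, ← ha3]
  ring

/-- Time reversal changes the signs of `κ`, `ω` and `F`, and so reduces this case to positive speed.
-/
theorem transport_balance_of_neg {κ ω e s t : ℝ} (hκ : κ < 0) (hω : κ + ω ≤ 0) (hst : s ≤ t)
    (hes : 0 ≤ e - ω * s) (het : 0 ≤ e - ω * t) {Y F : ℝ → ℝ → ℝ}
    (hF : IntegrableOn (fun p => F p.1 p.2) (trapezoid e ω s t))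
    (hYs : IntervalIntegrable (Y s) volume 0 (e - ω * s))
    (hYt : IntervalIntegrable (Y t) volume 0 (e - ω * t))
    (h0 : IntervalIntegrable (fun r => Y r 0) volume s t)
    (h1 : κ + ω ≠ 0 → IntervalIntegrable (fun r => Y r (e - ω * r)) volume s t)
    (hchar : ∀ᵐ b : ℝ, ∀ s' t', s ≤ s' → s' ≤ t' → t' ≤ t → b + κ * s' ∈ Icc 0 (e - ω * s') →
      b + κ * t' ∈ Icc 0 (e - ω * t') →
      Y t' (b + κ * t') = Y s' (b + κ * s') + ∫ r in s'..t', F r (b + κ * r)) :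
    (∫ x in (0 : ℝ)..(e - ω * t), Y t x) - ∫ x in (0 : ℝ)..(e - ω * s), Y s x =
      κ * (∫ r in s..t, Y r 0) - (κ + ω) * (∫ r in s..t, Y r (e - ω * r))
        + ∫ p in trapezoid e ω s t, F p.1 p.2 := by
  -- reverse time
  let ρ : ℝ × ℝ → ℝ × ℝ := fun p => (-p.1, p.2)
  have hρ : MeasurePreserving ρ volume volume := by
    rw [Measure.volume_eq_prod]
    exact (Measure.measurePreserving_neg volume).prod (MeasurePreserving.id _)
  have hρe : MeasurableEmbedding ρ :=
    ((MeasurableEquiv.neg ℝ).prodCongr (MeasurableEquiv.refl ℝ)).measurableEmbedding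
  -- Reversal turns `(s, t]` into `[-t, -s)`, so the sets agree only up to two vertical lines.
  have hset : (trapezoid e (-ω) (-t) (-s)) =ᵐ[volume] ρ ⁻¹' (trapezoid e ω s t) := by
    have hnull : ∀ᵐ p : ℝ × ℝ, p.1 ≠ -t ∧ p.1 ≠ -s := by
      rw [Measure.volume_eq_prod]
      have : ∀ c : ℝ, ∀ᵐ p : ℝ × ℝ ∂(volume.prod volume), p.1 ≠ c := fun c =>
        Measure.quasiMeasurePreserving_fst.ae (Measure.ae_ne volume c)
      exact (this _).and (this _)
    filter_upwards [hnull] with p hp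
    simp only [trapezoid, ρ, eq_iff_iff]
    show (_ ∧ _) ↔ (_ ∧ _)
    simp only [mem_Ioc, mul_neg, neg_mul]
    refine and_congr_left fun _ => ⟨fun h => ⟨?_, ?_⟩, fun h => ⟨?_, ?_⟩⟩
    · have := lt_of_le_of_ne h.2 hp.2
      linarith
    · linarith
    · exact lt_of_le_of_ne (by linarith) hp.1.symm
    · linarith
  have hflip : ∀ {h : ℝ → ℝ}, IntervalIntegrable h volume s t →
      IntervalIntegrable (fun r => h (-r)) volume (-t) (-s) := fun h =>
    ((IntervalIntegrable.iff_comp_neg (by simp)).1 h).symm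
  have hF' : IntegrableOn (fun p : ℝ × ℝ => -F (-p.1) p.2) (trapezoid e (-ω) (-t) (-s)) := by
    rw [integrableOn_congr_set_ae hset]
    exact ((hρ.integrableOn_comp_preimage hρe).2 hF).neg
  have main := transport_balance_of_pos (κ := -κ) (ω := -ω) (e := e) (s := -t) (t := -s)
    (by linarith) (by linarith) (by linarith) (by linarith) (by linarith)
    (Y := fun r x => Y (-r) x) (F := fun r x => -F (-r) x) hF' (by simpa using hYt)
    (by simpa using hYs) (hflip h0)
    (fun h => by simpa using hflip (h1 (by contrapose! h; linarith))) (by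
      filter_upwards [hchar] with b hb s' t' hs hst' ht h₁ h₂
      have := hb (-t') (-s') (by linarith) (by linarith) (by linarith) (by simpa using h₂)
        (by simpa using h₁)
      have e1 : ∫ r in s'..t', -F (-r) (b + -κ * r) = - ∫ r in (-t')..(-s'), F r (b + κ * r) := by
        rw [intervalIntegral.integral_neg, ← intervalIntegral.integral_comp_neg]
        simp
      rw [e1]
      simp only [mul_neg, neg_mul] at this ⊢
      linarith)
  have e0 : ∫ p in trapezoid e (-ω) (-t) (-s), -F (-p.1) p.2 =
      - ∫ p in trapezoid e ω s t, F p.1 p.2 := by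
    rw [setIntegral_congr_set hset, integral_neg]
    exact congrArg _ (hρ.setIntegral_preimage_emb hρe (fun p => F p.1 p.2) _)
  have e1 := intervalIntegral.integral_comp_neg (a := -t) (b := -s) fun r => Y r 0
  have e2 := intervalIntegral.integral_comp_neg (a := -t) (b := -s) fun r => Y r (e - ω * r)
  rw [e0] at main
  simp only [neg_neg, mul_neg, neg_mul] at main e1 e2
  rw [e1, e2] at main
  linarith

theorem transport_balance {κ ω e s t : ℝ}
    (hκ : (0 < κ ∧ 0 ≤ κ + ω) ∨ (κ < 0 ∧ κ + ω ≤ 0)) (hst : s ≤ t)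
    (hes : 0 ≤ e - ω * s) (het : 0 ≤ e - ω * t) {Y F : ℝ → ℝ → ℝ}
    (hF : IntegrableOn (fun p => F p.1 p.2) (trapezoid e ω s t))
    (hYs : IntervalIntegrable (Y s) volume 0 (e - ω * s))
    (hYt : IntervalIntegrable (Y t) volume 0 (e - ω * t))
    (h0 : IntervalIntegrable (fun r => Y r 0) volume s t)
    (h1 : κ + ω ≠ 0 → IntervalIntegrable (fun r => Y r (e - ω * r)) volume s t)
    (hchar : ∀ᵐ b : ℝ, ∀ s' t', s ≤ s' → s' ≤ t' → t' ≤ t → b + κ * s' ∈ Icc 0 (e - ω * s') →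
      b + κ * t' ∈ Icc 0 (e - ω * t') →
      IsPrimitive (fun r => Y r (b + κ * r)) (fun r => F r (b + κ * r)) s' t') :
    (∫ x in (0 : ℝ)..(e - ω * t), Y t x) - ∫ x in (0 : ℝ)..(e - ω * s), Y s x =
      κ * (∫ r in s..t, Y r 0) - (κ + ω) * (∫ r in s..t, Y r (e - ω * r))
        + ∫ p in trapezoid e ω s t, F p.1 p.2 := by
  have hchar' : ∀ᵐ b : ℝ, ∀ s' t', s ≤ s' → s' ≤ t' → t' ≤ t →
      b + κ * s' ∈ Icc 0 (e - ω * s') → b + κ * t' ∈ Icc 0 (e - ω * t') →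
      Y t' (b + κ * t') = Y s' (b + κ * s') + ∫ r in s'..t', F r (b + κ * r) := by
    filter_upwards [hchar] with b hb s' t' hs hst' ht h₁ h₂
    exact (hb s' t' hs hst' ht h₁ h₂).integral_eq hst'
  rcases hκ with ⟨h, h'⟩ | ⟨h, h'⟩
  · exact transport_balance_of_pos h h' hst hes het hF hYs hYt h0 h1 hchar'
  · exact transport_balance_of_neg h h' hst hes het hF hYs hYt h0 h1 hchar'

/-! ### Kernels on the triangle -/

section Triangle

variable {L : ℝ}

theorem convex_triangle (L : ℝ) : Convex ℝ (triangle L) := by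
  rintro ⟨x, y⟩ ⟨h1, h2, h3⟩ ⟨x', y'⟩ ⟨h1', h2', h3'⟩ a b ha hb hab
  simp only [triangle, mem_ofPred_eq, Prod.smul_mk, Prod.mk_add_mk, smul_eq_mul] at *
  refine ⟨by positivity, by gcongr, ?_⟩
  calc a * x + b * x' ≤ a * L + b * L := by gcongr
    _ = L := by rw [← add_mul, hab, one_mul]

theorem isClosed_triangle (L : ℝ) : IsClosed (triangle L) :=
  (isClosed_le continuous_const continuous_snd).inter
    ((isClosed_le continuous_snd continuous_fst).inter
      (isClosed_le continuous_fst continuous_const))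

theorem isCompact_triangle (L : ℝ) : IsCompact (triangle L) := by
  refine (isCompact_Icc (a := ((0 : ℝ), (0 : ℝ))) (b := (L, L))).of_isClosed_subset
    (isClosed_triangle L) ?_
  rintro ⟨x, y⟩ ⟨h1, h2, h3⟩
  exact ⟨⟨h1.trans h2, h1⟩, ⟨h3, h2.trans h3⟩⟩

theorem uniqueDiffOn_triangle (hL : 0 < L) : UniqueDiffOn ℝ (triangle L) := by
  refine uniqueDiffOn_convex (convex_triangle L) ⟨((L / 2, L / 4) : ℝ × ℝ), ?_⟩
  refine interior_mono (s := {p : ℝ × ℝ | 0 < p.2 ∧ p.2 < p.1 ∧ p.1 < L})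
    (t := triangle L) (fun p hp => And.intro hp.1.le ⟨hp.2.1.le, hp.2.2.le⟩) ?_
  have ho : IsOpen {p : ℝ × ℝ | 0 < p.2 ∧ p.2 < p.1 ∧ p.1 < L} :=
    (isOpen_lt continuous_const continuous_snd).inter
      ((isOpen_lt continuous_snd continuous_fst).inter
        (isOpen_lt continuous_fst continuous_const))
  rw [ho.interior_eq]
  exact ⟨by positivity, by show L / 4 < L / 2; linarith, by show L / 2 < L; linarith⟩

/-- Precomposition with a retraction of the plane onto the triangle. It serves measurability, as the
values of a kernel off the triangle are arbitrary. -/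
theorem exists_continuous_eqOn_triangle (hL : 0 ≤ L) {f : ℝ × ℝ → ℝ}
    (hf : ContinuousOn f (triangle L)) :
    ∃ f' : ℝ × ℝ → ℝ, Continuous f' ∧ EqOn f f' (triangle L) := by
  let π : ℝ × ℝ → ℝ × ℝ := fun p => (max 0 (min p.1 L), max 0 (min p.2 (max 0 (min p.1 L))))
  have hπ : Continuous π := by fun_prop
  have hm : ∀ p, π p ∈ triangle L := fun p =>
    ⟨le_max_left _ _, max_le (le_max_left _ _) (min_le_right _ _), max_le hL (min_le_right _ _)⟩
  refine ⟨f ∘ π, hf.comp_continuous hπ hm, ?_⟩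
  rintro ⟨x, y⟩ ⟨h1, h2, h3⟩
  simp only at h1 h2 h3
  have : π (x, y) = (x, y) := by
    simp [π, h1, h2, h3, h1.trans h2]
  simp [this]

theorem continuousOn_fderivWithin_triangle (hL : 0 < L) {f : ℝ × ℝ → ℝ}
    (hf : ContDiffOn ℝ 1 f (triangle L)) (e : ℝ × ℝ) :
    ContinuousOn (fun p => fderivWithin ℝ f (triangle L) p e) (triangle L) :=
  (hf.continuousOn_fderivWithin (uniqueDiffOn_triangle hL) le_rfl).clm_apply continuousOn_const

/-- The chain rule along a segment, which stays in the triangle by convexity. Derivatives within the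
triangle suffice even if the segment lies on its boundary, as it does when the kernel is followed
along the diagonal. -/
theorem isPrimitive_comp_triangle (hL : 0 < L) {f : ℝ × ℝ → ℝ}
    (hf : ContDiffOn ℝ 1 f (triangle L)) {c b ω κ s t : ℝ} (hst : s ≤ t)
    (hs : (c - ω * s, b + κ * s) ∈ triangle L) (ht : (c - ω * t, b + κ * t) ∈ triangle L) :
    IsPrimitive (fun r => f (c - ω * r, b + κ * r))
      (fun r => -ω * fderivWithin ℝ f (triangle L) (c - ω * r, b + κ * r) (1, 0)
        + κ * fderivWithin ℝ f (triangle L) (c - ω * r, b + κ * r) (0, 1)) s t := by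
  have hm : MapsTo (fun r => (c - ω * r, b + κ * r)) (Icc s t) (triangle L) := by
    intro r hr
    rw [← segment_eq_Icc hst] at hr
    obtain ⟨α, β, hα, hβ, hαβ, rfl⟩ := hr
    have := convex_triangle L hs ht hα hβ hαβ
    convert this using 1
    have hα' : α = 1 - β := by linarith
    subst hα'
    ext <;> simp <;> ring
  have hcont : Continuous fun r : ℝ => (c - ω * r, b + κ * r) := by fun_prop
  refine IsPrimitive.of_hasDerivWithinAt hst ?_ fun r hr => ?_
  · exact (((continuousOn_fderivWithin_triangle hL hf _).comp hcont.continuousOn hm).const_mul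
      (-ω)).add (((continuousOn_fderivWithin_triangle hL hf _).comp hcont.continuousOn hm).const_mul
      κ)
  · have h1 := (hf.differentiableOn one_ne_zero _ (hm hr)).hasFDerivWithinAt
    have h2 : HasDerivWithinAt (fun r => (c - ω * r, b + κ * r)) (-ω, κ) (Icc s t) r := by
      have ha : HasDerivAt (fun r => c - ω * r) (-ω) r := by
        simpa using ((hasDerivAt_id r).const_mul ω).const_sub c
      have hb : HasDerivAt (fun r => b + κ * r) κ r := by
        simpa using ((hasDerivAt_id r).const_mul κ).const_add b
      exact (ha.prodMk hb).hasDerivWithinAt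
    have h3 := h1.comp_hasDerivWithinAt r h2 hm
    have : ((-ω, κ) : ℝ × ℝ) = (-ω) • (1, 0) + κ • (0, 1) := by simp
    rw [this, map_add, map_smul, map_smul] at h3
    exact h3

end Triangle

/-! ### Bounds and measurability of the Volterra term -/

section Profile

variable {L : ℝ} {a : ℝ → Fin 3 → ℝ} {b : ℝ → ℝ}

theorem InL2.integrableOn_sq (h : InL2 L a b) :
    IntegrableOn (fun x => (∑ i, a x i ^ 2) + b x ^ 2) (Ioc 0 L) :=
  (integrable_finsetSum _ fun i _ => (h.1 i).integrable_sq).add h.2.integrable_sq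

theorem normSq_nonneg (hL : 0 ≤ L) (a : ℝ → Fin 3 → ℝ) (b : ℝ → ℝ) : 0 ≤ normSq L a b :=
  intervalIntegral.integral_nonneg hL fun x _ => by positivity

theorem abs_volterra_le {K : Fin 3 → ℝ × ℝ → ℝ} {M : ℝ × ℝ → ℝ} {C : ℝ} (hL : 0 ≤ L)
    (hK : ∀ i, ∀ p ∈ triangle L, |K i p| ≤ C) (hM : ∀ p ∈ triangle L, |M p| ≤ C)
    (h : InL2 L a b) {x : ℝ} (hx : x ∈ Icc 0 L) :
    |volterra K M a b x| ≤ C * (4 * L + normSq L a b) := by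
  have hC : 0 ≤ C := (abs_nonneg _).trans (hM (0, 0) ⟨le_rfl, le_rfl, hL⟩)
  have hint : IntervalIntegrable (fun x => C * (4 + ((∑ i, a x i ^ 2) + b x ^ 2))) volume 0 L := by
    rw [intervalIntegrable_iff_integrableOn_Ioc_of_le hL]
    exact ((integrableOn_const (by simp)).add h.integrableOn_sq).const_mul C
  have hint' := hint.mono_set (a := 0) (b := L) (c := 0) (d := x) (by
    rw [uIcc_of_le hx.1, uIcc_of_le hL]; exact Icc_subset_Icc_right hx.2)
  have h1 : |volterra K M a b x| ≤
      ∫ x in (0 : ℝ)..x, C * (4 + ((∑ i, a x i ^ 2) + b x ^ 2)) := by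
    rw [← Real.norm_eq_abs]
    refine intervalIntegral.norm_integral_le_of_norm_le hx.1 (ae_of_all _ fun ξ hξ => ?_) hint'
    have hm : (x, ξ) ∈ triangle L := ⟨hξ.1.le, hξ.2, hx.2⟩
    -- A crude bound is enough, since only boundedness is used later; the four components contribute
    -- the `4` in `4 * L`.
    have hsq : ∀ y : ℝ, |y| ≤ 1 + y ^ 2 := fun y => by
      rw [← sq_abs y]; nlinarith [sq_nonneg (|y| - 1), abs_nonneg y]
    have hk : ∀ k y : ℝ, |k| ≤ C → |k * y| ≤ C * (1 + y ^ 2) := fun k y hk => by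
      rw [abs_mul]
      exact mul_le_mul hk (hsq y) (abs_nonneg _) hC
    rw [Real.norm_eq_abs]
    refine (abs_add_le _ _).trans ?_
    have e1 := (Finset.abs_sum_le_sum_abs (fun i => K i (x, ξ) * a ξ i) Finset.univ).trans
      (Finset.sum_le_sum fun i _ => hk _ (a ξ i) (hK i _ hm))
    have e2 := hk _ (b ξ) (hM _ hm)
    simp only [Fin.sum_univ_three] at e1 ⊢
    linarith
  refine h1.trans ?_
  have h2 : ∫ x in (0 : ℝ)..L, C * (4 + ((∑ i, a x i ^ 2) + b x ^ 2))
      = C * (4 * L + normSq L a b) := by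
    rw [intervalIntegral.integral_const_mul, intervalIntegral.integral_add
      intervalIntegrable_const ((intervalIntegrable_iff_integrableOn_Ioc_of_le hL).2
      h.integrableOn_sq)]
    simp [normSq, mul_comm]
  rw [← h2]
  refine intervalIntegral.integral_mono_interval le_rfl hx.1 hx.2 (ae_of_all _ fun y => ?_) hint
  simp only [Pi.zero_apply]
  positivity

end Profile

section Volterra

variable {L : ℝ} {K : Fin 3 → ℝ × ℝ → ℝ} {M : ℝ × ℝ → ℝ} {u : ℝ → ℝ → Fin 3 → ℝ}
  {v : ℝ → ℝ → ℝ}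

theorem exists_measurable_volterra (hL : 0 ≤ L) (hK : ∀ i, ContinuousOn (K i) (triangle L))
    (hM : ContinuousOn M (triangle L)) (hu : ∀ i, Measurable (fun p : ℝ × ℝ => u p.1 p.2 i))
    (hv : Measurable (fun p : ℝ × ℝ => v p.1 p.2)) :
    ∃ Φ : ℝ × ℝ → ℝ, Measurable Φ ∧
      ∀ t, ∀ x ∈ Icc 0 L, volterra K M (u t) (v t) x = Φ (t, x) := by
  choose K' hK' hKe using fun i => exists_continuous_eqOn_triangle hL (hK i)
  obtain ⟨M', hM', hMe⟩ := exists_continuous_eqOn_triangle hL hM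
  let f : (ℝ × ℝ) × ℝ → ℝ := fun q => {q : (ℝ × ℝ) × ℝ | 0 < q.2 ∧ q.2 ≤ q.1.2}.indicator
    (fun q => (∑ i, K' i (q.1.2, q.2) * u q.1.1 q.2 i) + M' (q.1.2, q.2) * v q.1.1 q.2) q
  have hf : Measurable f := by
    refine Measurable.indicator ?_ ((measurableSet_lt measurable_const measurable_snd).inter
      (measurableSet_le measurable_snd (by fun_prop)))
    have hp : Measurable fun q : (ℝ × ℝ) × ℝ => (q.1.1, q.2) := by fun_prop
    have hq : Measurable fun q : (ℝ × ℝ) × ℝ => (q.1.2, q.2) := by fun_prop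
    exact (Finset.measurable_sum _ fun i _ =>
      ((hK' i).measurable.comp hq).mul ((hu i).comp hp)).add
      ((hM'.measurable.comp hq).mul (hv.comp hp))
  refine ⟨fun p => ∫ ξ, f (p, ξ), (hf.stronglyMeasurable.integral_prod_right').measurable, ?_⟩
  intro t x hx
  rw [volterra, intervalIntegral.integral_of_le hx.1, ← integral_indicator measurableSet_Ioc]
  refine integral_congr_ae (ae_of_all _ fun ξ => ?_)
  by_cases hξ : ξ ∈ Ioc 0 x
  · have hm : (x, ξ) ∈ triangle L := ⟨hξ.1.le, hξ.2, hx.2⟩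
    have hm' : ((t, x), ξ) ∈ {q : (ℝ × ℝ) × ℝ | 0 < q.2 ∧ q.2 ≤ q.1.2} := hξ
    simp only [f, indicator_of_mem hξ, indicator_of_mem hm', hMe hm, fun i => hKe i hm]
  · have hm' : ((t, x), ξ) ∉ {q : (ℝ × ℝ) × ℝ | 0 < q.2 ∧ q.2 ≤ q.1.2} := hξ
    simp only [f, indicator_of_notMem hξ, indicator_of_notMem hm']

end Volterra

/-! ### Space-time integrability of a solution -/

theorem Icc_subset_timeDomain {T : EReal} {τ : ℝ} (hτ : τ ∈ timeDomain T) :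
    Icc 0 τ ⊆ timeDomain T := fun _ ht =>
  ⟨ht.1, lt_of_le_of_lt (EReal.coe_le_coe_iff.2 ht.2) hτ.2⟩

theorem normSq_le_two_mul_add {L : ℝ} (hL : 0 ≤ L) {a a' : ℝ → Fin 3 → ℝ} {b b' : ℝ → ℝ}
    (h : InL2 L a b) (h' : InL2 L a' b') :
    normSq L a b ≤ 2 * normSq L (a - a') (b - b') + 2 * normSq L a' b' := by
  have hd : InL2 L (a - a') (b - b') :=
    ⟨fun i => (h.1 i).sub (h'.1 i), h.2.sub h'.2⟩
  simp only [normSq, intervalIntegral.integral_of_le hL]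
  rw [← integral_const_mul, ← integral_const_mul, ← integral_add (hd.integrableOn_sq.const_mul 2)
    (h'.integrableOn_sq.const_mul 2)]
  refine integral_mono h.integrableOn_sq ((hd.integrableOn_sq.const_mul 2).add
    (h'.integrableOn_sq.const_mul 2)) fun x => ?_
  have key : ∀ y z : ℝ, y ^ 2 ≤ 2 * (y - z) ^ 2 + 2 * z ^ 2 := fun y z => by
    nlinarith [sq_nonneg (y - 2 * z)]
  simp only [Fin.sum_univ_three, Pi.sub_apply]
  linarith [key (a x 0) (a' x 0), key (a x 1) (a' x 1), key (a x 2) (a' x 2), key (b x) (b' x)]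

namespace IsSolution

variable {P : Plant} {T : EReal} {U : ℝ → ℝ} {u : ℝ → ℝ → Fin 3 → ℝ} {v : ℝ → ℝ → ℝ} {τ : ℝ}
  {K : Fin 3 → ℝ × ℝ → ℝ} {M : ℝ × ℝ → ℝ}

/-- Continuity in time with values in `L²` bounds the norm near each time, and compactness of `[0,
τ]` makes the bound uniform. -/
theorem exists_normSq_le (h : IsSolution P T U u v) (hτ : τ ∈ timeDomain T) :
    ∃ C, ∀ t ∈ Icc 0 τ, normSq P.L (u t) (v t) ≤ C := by
  have hsub := Icc_subset_timeDomain hτ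
  refine isCompact_Icc.induction_on (p := fun S => ∃ C, ∀ t ∈ S, normSq P.L (u t) (v t) ≤ C)
    ⟨0, by simp⟩ (fun S S' hS ⟨C, hC⟩ => ⟨C, fun t ht => hC t (hS ht)⟩)
    (fun S S' ⟨C, hC⟩ ⟨C', hC'⟩ => ⟨max C C', ?_⟩) fun t₀ ht₀ => ?_
  · rintro t (ht | ht)
    exacts [(hC t ht).trans (le_max_left _ _), (hC' t ht).trans (le_max_right _ _)]
  · have h1 := (h.cont t₀ (hsub ht₀)).mono_left (nhdsWithin_mono t₀ hsub)
    have h2 := h1.eventually (gt_mem_nhds zero_lt_one)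
    refine ⟨_, inter_mem h2 self_mem_nhdsWithin, 2 * 1 + 2 * normSq P.L (u t₀) (v t₀), ?_⟩
    rintro t ⟨ht, htm⟩
    refine (normSq_le_two_mul_add P.L_pos.le (h.inL2 t (hsub htm))
      (h.inL2 t₀ (hsub ht₀))).trans ?_
    have : normSq P.L (u t - u t₀) (v t - v t₀) < 1 := ht
    linarith

end IsSolution

/-- A measurable function on a space-time rectangle whose time slices are bounded in `L²`. -/
theorem memLp_rect {τ L C : ℝ} (hL : 0 ≤ L) {y : ℝ → ℝ → ℝ}
    (hm : Measurable (fun p : ℝ × ℝ => y p.1 p.2))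
    (hs : ∀ t ∈ Icc 0 τ, MemLp (y t) 2 (volume.restrict (Ioc 0 L)))
    (hC : ∀ t ∈ Icc 0 τ, ∫ x in (0 : ℝ)..L, y t x ^ 2 ≤ C) :
    MemLp (fun p : ℝ × ℝ => y p.1 p.2) 2 (volume.restrict (Icc 0 τ ×ˢ Icc 0 L)) := by
  rw [memLp_two_iff_integrable_sq hm.aestronglyMeasurable, Measure.volume_eq_prod,
    ← Measure.prod_restrict, Measure.restrict_congr_set (Ioc_ae_eq_Icc (a := (0 : ℝ)) (b := L)).symm,
    integrable_prod_iff (hm.pow_const 2).aestronglyMeasurable]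
  refine ⟨?_, ?_⟩
  · filter_upwards [ae_restrict_mem measurableSet_Icc] with t ht
    exact (hs t ht).integrable_sq
  · refine Measure.integrableOn_of_bounded (M := C) (by simp) ?_ ?_
    · exact (hm.pow_const 2).norm.stronglyMeasurable.integral_prod_right'.aestronglyMeasurable
    · filter_upwards [ae_restrict_mem measurableSet_Icc] with t ht
      have h1 := hC t ht
      rw [intervalIntegral.integral_of_le hL] at h1
      simp only [norm_pow, Real.norm_eq_abs, sq_abs]
      rwa [abs_of_nonneg (integral_nonneg fun x => by positivity)]

namespace IsSolution

variable {P : Plant} {T : EReal} {U : ℝ → ℝ} {u : ℝ → ℝ → Fin 3 → ℝ} {v : ℝ → ℝ → ℝ} {τ : ℝ}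
  {K : Fin 3 → ℝ × ℝ → ℝ} {M : ℝ × ℝ → ℝ}

theorem memLp_u (h : IsSolution P T U u v) (hτ : τ ∈ timeDomain T) (i : Fin 3) :
    MemLp (fun p : ℝ × ℝ => u p.1 p.2 i) 2 (volume.restrict (Icc 0 τ ×ˢ Icc 0 P.L)) := by
  obtain ⟨C, hC⟩ := h.exists_normSq_le hτ
  have hin := fun t ht => h.inL2 t (Icc_subset_timeDomain hτ ht)
  refine memLp_rect (y := fun t x => u t x i) (C := C) P.L_pos.le (h.meas_u i)
    (fun t ht => (hin t ht).1 i) fun t ht => le_trans ?_ (hC t ht)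
  simp only [normSq, intervalIntegral.integral_of_le P.L_pos.le]
  refine integral_mono ((hin t ht).1 i).integrable_sq (hin t ht).integrableOn_sq fun x => ?_
  have := Finset.single_le_sum (f := fun i => u t x i ^ 2) (fun j _ => sq_nonneg _)
    (Finset.mem_univ i)
  simp only at this ⊢
  nlinarith [sq_nonneg (v t x)]

theorem memLp_v (h : IsSolution P T U u v) (hτ : τ ∈ timeDomain T) :
    MemLp (fun p : ℝ × ℝ => v p.1 p.2) 2 (volume.restrict (Icc 0 τ ×ˢ Icc 0 P.L)) := by
  obtain ⟨C, hC⟩ := h.exists_normSq_le hτ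
  have hin := fun t ht => h.inL2 t (Icc_subset_timeDomain hτ ht)
  refine memLp_rect (C := C) P.L_pos.le h.meas_v
    (fun t ht => (hin t ht).2) fun t ht => le_trans ?_ (hC t ht)
  simp only [normSq, intervalIntegral.integral_of_le P.L_pos.le]
  refine integral_mono (hin t ht).2.integrable_sq (hin t ht).integrableOn_sq fun x => ?_
  have := Finset.sum_nonneg (f := fun i => u t x i ^ 2) (s := Finset.univ)
    (fun j _ => sq_nonneg _)
  simp only at this ⊢
  linarith

theorem exists_abs_volterra_le (h : IsSolution P T U u v) (hτ : τ ∈ timeDomain T)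
    (hK : ∀ i, ContinuousOn (K i) (triangle P.L)) (hM : ContinuousOn M (triangle P.L)) :
    ∃ C, ∀ t ∈ Icc 0 τ, ∀ x ∈ Icc 0 P.L, |volterra K M (u t) (v t) x| ≤ C := by
  obtain ⟨C, hC⟩ := h.exists_normSq_le hτ
  choose k hk using fun i => (isCompact_triangle P.L).exists_bound_of_continuousOn (hK i)
  obtain ⟨m, hm⟩ := (isCompact_triangle P.L).exists_bound_of_continuousOn hM
  have hm0 : 0 ≤ m :=
    (norm_nonneg _).trans (hm ((0 : ℝ), (0 : ℝ)) ⟨le_rfl, le_rfl, P.L_pos.le⟩)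
  have hk0 : ∀ i, 0 ≤ k i := fun i =>
    (norm_nonneg _).trans (hk i ((0 : ℝ), (0 : ℝ)) ⟨le_rfl, le_rfl, P.L_pos.le⟩)
  have hks : 0 ≤ ∑ j, k j := Finset.sum_nonneg fun j _ => hk0 j
  refine ⟨(m + ∑ i, k i) * (4 * P.L + C), fun t ht x hx => ?_⟩
  refine (abs_volterra_le (C := m + ∑ i, k i) P.L_pos.le (fun i p hp => (hk i p hp).trans ?_)
    (fun p hp => (hm p hp).trans ?_) (h.inL2 t (Icc_subset_timeDomain hτ ht)) hx).trans ?_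
  · have := Finset.single_le_sum (f := k) (fun j _ => hk0 j) (Finset.mem_univ i)
    linarith
  · exact le_add_of_nonneg_right hks
  · gcongr
    exact hC t ht

theorem inL2_backstep (h : IsSolution P T U u v) (hτ : τ ∈ timeDomain T)
    (hK : ∀ i, ContinuousOn (K i) (triangle P.L)) (hM : ContinuousOn M (triangle P.L)) :
    InL2 P.L (u τ) (backstep K M (u τ) (v τ)) := by
  obtain ⟨C, hC⟩ := h.exists_abs_volterra_le hτ hK hM
  obtain ⟨Φ, hΦ, hΦe⟩ := exists_measurable_volterra P.L_pos.le hK hM h.meas_u h.meas_v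
  refine ⟨(h.inL2 τ hτ).1, (h.inL2 τ hτ).2.sub ?_⟩
  have hmem : τ ∈ Icc 0 τ := right_mem_Icc.2 hτ.1
  have hm : AEStronglyMeasurable (volterra K M (u τ) (v τ)) (volume.restrict (Ioc 0 P.L)) := by
    refine (hΦ.comp measurable_prodMk_left).aestronglyMeasurable.congr
      (f := fun x => Φ (τ, x)) ?_
    filter_upwards [ae_restrict_mem measurableSet_Ioc] with x hx
    exact (hΦe τ x (Ioc_subset_Icc_self hx)).symm
  refine MemLp.of_bound hm C ?_
  filter_upwards [ae_restrict_mem measurableSet_Ioc] with x hx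
  exact hC τ hmem x (Ioc_subset_Icc_self hx)

theorem memLp_backstep (h : IsSolution P T U u v) (hτ : τ ∈ timeDomain T)
    (hK : ∀ i, ContinuousOn (K i) (triangle P.L)) (hM : ContinuousOn M (triangle P.L)) :
    MemLp (fun p : ℝ × ℝ => backstep K M (u p.1) (v p.1) p.2) 2
      (volume.restrict (Icc 0 τ ×ˢ Icc 0 P.L)) := by
  obtain ⟨C, hC⟩ := h.exists_abs_volterra_le hτ hK hM
  obtain ⟨Φ, hΦ, hΦe⟩ := exists_measurable_volterra P.L_pos.le hK hM h.meas_u h.meas_v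
  have hmem := ae_restrict_mem (μ := (volume : Measure (ℝ × ℝ)))
    ((measurableSet_Icc (a := (0 : ℝ)) (b := τ)).prod
      (measurableSet_Icc (a := (0 : ℝ)) (b := P.L)))
  have : IsFiniteMeasure ((volume : Measure (ℝ × ℝ)).restrict (Icc 0 τ ×ˢ Icc 0 P.L)) :=
    isFiniteMeasure_restrict.2 (isCompact_Icc.prod isCompact_Icc).measure_lt_top.ne
  refine (h.memLp_v hτ).sub (MemLp.of_bound (f := fun p : ℝ × ℝ =>
    volterra K M (u p.1) (v p.1) p.2) ?_ C ?_)
  · refine hΦ.aestronglyMeasurable.congr ?_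
    filter_upwards [hmem] with p hp
    exact (hΦe p.1 p.2 hp.2).symm
  · filter_upwards [hmem] with p hp
    exact hC p.1 hp.1 p.2 hp.2

end IsSolution

/-! ### Balance laws for weighted squares and for moving kernels -/

theorem intervalIntegrable_of_sq {y : ℝ → ℝ} {a b : ℝ} (hm : Measurable y)
    (h : IntervalIntegrable (fun r => y r ^ 2) volume a b) : IntervalIntegrable y volume a b := by
  refine ((intervalIntegrable_const (c := (1 : ℝ))).add h).mono_fun hm.aestronglyMeasurable
    (ae_of_all _ fun r => ?_)
  simp only [Real.norm_eq_abs]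
  rw [abs_of_nonneg (a := 1 + y r ^ 2) (by positivity), ← sq_abs (y r)]
  nlinarith [sq_nonneg (|y r| - 1), abs_nonneg (y r)]

theorem trapezoid_subset {e ω s t τ L : ℝ} (hs : 0 ≤ s) (ht : t ≤ τ)
    (h : ∀ r ∈ Icc s t, e - ω * r ≤ L) : trapezoid e ω s t ⊆ Icc 0 τ ×ˢ Icc 0 L := by
  rintro ⟨r, x⟩ ⟨⟨h1, h2⟩, h3, h4⟩
  exact ⟨⟨hs.trans h1.le, h2.trans ht⟩, h3.le, h4.trans (h r ⟨h1.le, h2⟩)⟩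

/-- Multiplication by a function that is continuous on a compact set. -/
theorem integrableOn_continuousOn_mul {X : Type*} [TopologicalSpace X] [MeasurableSpace X]
    [OpensMeasurableSpace X] [T2Space X]
    {μ : Measure X} {g k : X → ℝ} {S C : Set X} (hg : IntegrableOn g S μ)
    (hk : ContinuousOn k C) (hC : IsCompact C) (hS : MeasurableSet S) (hSC : S ⊆ C) :
    IntegrableOn (fun x => k x * g x) S μ := by
  obtain ⟨c, hc⟩ := hC.exists_bound_of_continuousOn hk
  have : AEStronglyMeasurable k (μ.restrict S) :=
    ((hk.aestronglyMeasurable_of_isCompact hC hC.measurableSet).mono_measure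
      (Measure.restrict_mono hSC le_rfl))
  refine Integrable.bdd_mul (c := c) hg this ?_
  filter_upwards [ae_restrict_mem hS] with x hx
  exact hc x (hSC hx)

theorem exists_isCompact_superset_trapezoid (e ω s t : ℝ) :
    ∃ C, IsCompact C ∧ trapezoid e ω s t ⊆ C ∧
      ∀ p ∈ C, p.1 ∈ Icc s t ∧ p.2 ∈ Icc 0 (e - ω * p.1) := by
  obtain ⟨c, hc⟩ := (isCompact_Icc (a := s) (b := t)).exists_bound_of_continuousOn
    (f := fun r => e - ω * r) (by fun_prop)
  refine ⟨{p | p.1 ∈ Icc s t ∧ p.2 ∈ Icc 0 (e - ω * p.1)}, ?_,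
    fun p hp => ⟨Ioc_subset_Icc_self hp.1, Ioc_subset_Icc_self hp.2⟩, fun p hp => hp⟩
  refine (isCompact_Icc (a := (s, (0 : ℝ))) (b := (t, c))).of_isClosed_subset ?_ ?_
  · exact (isClosed_Icc.preimage continuous_fst).inter
      ((isClosed_le continuous_const continuous_snd).inter
        (isClosed_le continuous_snd (by fun_prop)))
  · rintro ⟨r, x⟩ ⟨h1, h2⟩
    exact ⟨⟨h1.1, h2.1⟩, h1.2, h2.2.trans ((le_abs_self _).trans (hc r h1))⟩

/-- The balance law for the weighted square of a transported quantity. -/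
theorem energy_balance {κ τ L : ℝ} (hκ : κ ≠ 0) (hτ : 0 ≤ τ) (hL : 0 ≤ L) {φ φ' : ℝ → ℝ}
    (hφ : ∀ x, HasDerivAt φ (φ' x) x) (hφ' : Continuous φ') {y f : ℝ → ℝ → ℝ}
    (hy : MemLp (fun p : ℝ × ℝ => y p.1 p.2) 2 (volume.restrict (Icc 0 τ ×ˢ Icc 0 L)))
    (hyf : IntegrableOn (fun p : ℝ × ℝ => y p.1 p.2 * f p.1 p.2) (Icc 0 τ ×ˢ Icc 0 L))
    (hy0 : MemLp (y 0) 2 (volume.restrict (Ioc 0 L)))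
    (hyτ : MemLp (y τ) 2 (volume.restrict (Ioc 0 L)))
    (ht0 : IntervalIntegrable (fun r => y r 0 ^ 2) volume 0 τ)
    (htL : IntervalIntegrable (fun r => y r L ^ 2) volume 0 τ)
    (hchar : ∀ᵐ b : ℝ, ∀ s t, 0 ≤ s → s ≤ t → t ≤ τ → b + κ * s ∈ Icc 0 L →
      b + κ * t ∈ Icc 0 L →
      IsPrimitive (fun r => y r (b + κ * r)) (fun r => f r (b + κ * r)) s t) :
    IntegrableOn (fun p : ℝ × ℝ => κ * φ' p.2 * y p.1 p.2 ^ 2 +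
        2 * φ p.2 * (y p.1 p.2 * f p.1 p.2)) (Ioc 0 τ ×ˢ Ioc 0 L) ∧
    (∫ x in (0 : ℝ)..L, φ x * y τ x ^ 2) - ∫ x in (0 : ℝ)..L, φ x * y 0 x ^ 2 =
      κ * (∫ r in (0 : ℝ)..τ, φ 0 * y r 0 ^ 2) - κ * (∫ r in (0 : ℝ)..τ, φ L * y r L ^ 2)
        + ∫ p in Ioc 0 τ ×ˢ Ioc 0 L, (κ * φ' p.2 * y p.1 p.2 ^ 2 +
          2 * φ p.2 * (y p.1 p.2 * f p.1 p.2)) := by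
  have hφc : Continuous φ := continuous_iff_continuousAt.2 fun x => (hφ x).continuousAt
  have hset : Ioc 0 τ ×ˢ Ioc 0 L = trapezoid L 0 0 τ := by
    ext p
    simp [trapezoid]
  have hmS : MeasurableSet (Ioc 0 τ ×ˢ Ioc 0 L) := measurableSet_Ioc.prod measurableSet_Ioc
  have hsub : Ioc 0 τ ×ˢ Ioc 0 L ⊆ Icc 0 τ ×ˢ Icc 0 L :=
    prod_mono Ioc_subset_Icc_self Ioc_subset_Icc_self
  have hcpt : IsCompact (Icc (0 : ℝ) τ ×ˢ Icc (0 : ℝ) L) := isCompact_Icc.prod isCompact_Icc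
  have hF : IntegrableOn (fun p : ℝ × ℝ => κ * φ' p.2 * y p.1 p.2 ^ 2 +
        2 * φ p.2 * (y p.1 p.2 * f p.1 p.2)) (Ioc 0 τ ×ˢ Ioc 0 L) := by
    refine Integrable.add ?_ ?_
    · exact integrableOn_continuousOn_mul (k := fun p : ℝ × ℝ => κ * φ' p.2)
        (IntegrableOn.mono_set hy.integrable_sq hsub) (by fun_prop) hcpt hmS hsub
    · exact integrableOn_continuousOn_mul (k := fun p : ℝ × ℝ => 2 * φ p.2)
        (hyf.mono_set hsub) (by fun_prop) hcpt hmS hsub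
  refine ⟨hF, ?_⟩
  have hsl : ∀ {z : ℝ → ℝ}, MemLp z 2 (volume.restrict (Ioc 0 L)) →
      IntervalIntegrable (fun x => φ x * z x ^ 2) volume 0 (L - 0 * τ) := fun hz => by
    rw [zero_mul, sub_zero]
    exact ((intervalIntegrable_iff_integrableOn_Ioc_of_le hL).2 hz.integrable_sq).continuousOn_mul
      hφc.continuousOn
  -- The right end is at rest, so the trapezoid is a rectangle; `F` is the derivative of `φ y²`
  -- along a characteristic, by the product rule for primitives.
  have := transport_balance (κ := κ) (ω := 0) (e := L) (s := 0) (t := τ)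
    (Y := fun r x => φ x * y r x ^ 2)
    (F := fun r x => κ * φ' x * y r x ^ 2 + 2 * φ x * (y r x * f r x))
    (by rcases hκ.lt_or_gt with h | h <;> simp [h, h.le]) hτ (by simpa) (by simpa)
    (hset ▸ hF) (by simpa using hsl hy0) (hsl hyτ) (ht0.const_mul _)
    (fun _ => by simpa using htL.const_mul (φ L)) (by
      filter_upwards [hchar] with b hb s t hs hst ht h₁ h₂
      simp only [zero_mul, sub_zero] at h₁ h₂
      have hp := hb s t hs hst ht h₁ h₂
      have hd : IsPrimitive (fun r => φ (b + κ * r)) (fun r => φ' (b + κ * r) * κ) s t := by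
        refine IsPrimitive.of_hasDerivWithinAt hst (by fun_prop) fun r _ => ?_
        have : HasDerivAt (fun r => b + κ * r) κ r := by
          simpa using ((hasDerivAt_id r).const_mul κ).const_add b
        exact ((hφ _).comp r this).hasDerivWithinAt
      exact (hd.mul (hp.mul hp hst) hst).congr hst (fun r _ => by ring) fun r _ => by ring)
  rw [hset]
  simpa using this

/-- The balance law for a transported quantity multiplied by a kernel that moves with the right
end point `c - ω r`. -/
theorem kernel_balance {κ ω c s t τ L : ℝ} (hκ : (0 < κ ∧ 0 ≤ κ + ω) ∨ (κ < 0 ∧ κ + ω ≤ 0))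
    (hω : 0 ≤ ω) (hL : 0 < L) (hs : 0 ≤ s) (hst : s ≤ t) (ht : t ≤ τ)
    (hcs : c - ω * s ∈ Icc 0 L) (hct : c - ω * t ∈ Icc 0 L)
    {k : ℝ × ℝ → ℝ} (hk : ContDiffOn ℝ 1 k (triangle L)) {y f : ℝ → ℝ → ℝ}
    (hy : IntegrableOn (fun p : ℝ × ℝ => y p.1 p.2) (Icc 0 τ ×ˢ Icc 0 L))
    (hf : IntegrableOn (fun p : ℝ × ℝ => f p.1 p.2) (Icc 0 τ ×ˢ Icc 0 L))
    (hys : IntegrableOn (y s) (Ioc 0 L)) (hyt : IntegrableOn (y t) (Ioc 0 L))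
    (ht0 : IntervalIntegrable (fun r => y r 0) volume s t)
    (ht1 : κ + ω ≠ 0 → IntervalIntegrable (fun r => y r (c - ω * r)) volume s t)
    (hchar : ∀ᵐ b : ℝ, ∀ s t, 0 ≤ s → s ≤ t → t ≤ τ → b + κ * s ∈ Icc 0 L →
      b + κ * t ∈ Icc 0 L →
      IsPrimitive (fun r => y r (b + κ * r)) (fun r => f r (b + κ * r)) s t) :
    IntervalIntegrable (fun x => k (c - ω * s, x) * y s x) volume 0 (c - ω * s) ∧
    IntervalIntegrable (fun x => k (c - ω * t, x) * y t x) volume 0 (c - ω * t) ∧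
    IntervalIntegrable (fun r => k (c - ω * r, 0) * y r 0) volume s t ∧
    (κ + ω ≠ 0 →
      IntervalIntegrable (fun r => k (c - ω * r, c - ω * r) * y r (c - ω * r)) volume s t) ∧
    IntegrableOn (fun p : ℝ × ℝ =>
      (-ω * fderivWithin ℝ k (triangle L) (c - ω * p.1, p.2) (1, 0)
        + κ * fderivWithin ℝ k (triangle L) (c - ω * p.1, p.2) (0, 1)) * y p.1 p.2
        + k (c - ω * p.1, p.2) * f p.1 p.2) (trapezoid c ω s t) ∧
    (∫ x in (0 : ℝ)..(c - ω * t), k (c - ω * t, x) * y t x)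
        - ∫ x in (0 : ℝ)..(c - ω * s), k (c - ω * s, x) * y s x =
      κ * (∫ r in s..t, k (c - ω * r, 0) * y r 0)
        - (κ + ω) * (∫ r in s..t, k (c - ω * r, c - ω * r) * y r (c - ω * r))
        + ∫ p in trapezoid c ω s t,
          ((-ω * fderivWithin ℝ k (triangle L) (c - ω * p.1, p.2) (1, 0)
            + κ * fderivWithin ℝ k (triangle L) (c - ω * p.1, p.2) (0, 1)) * y p.1 p.2
            + k (c - ω * p.1, p.2) * f p.1 p.2) := by
  have hc : ∀ r ∈ Icc s t, c - ω * r ∈ Icc 0 L := fun r hr =>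
    ⟨hct.1.trans (by nlinarith [hr.2]), le_trans (by nlinarith [hr.1]) hcs.2⟩
  have hkc := hk.continuousOn
  have hsl : ∀ r ∈ Icc s t, IntegrableOn (y r) (Ioc 0 L) →
      IntervalIntegrable (fun x => k (c - ω * r, x) * y r x) volume 0 (c - ω * r) := by
    intro r hr hi
    have h1 : IntervalIntegrable (y r) volume 0 (c - ω * r) := by
      rw [intervalIntegrable_iff_integrableOn_Ioc_of_le (hc r hr).1]
      exact hi.mono_set (Ioc_subset_Ioc_right (hc r hr).2)
    refine h1.continuousOn_mul ?_
    rw [uIcc_of_le (hc r hr).1]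
    exact hkc.comp (by fun_prop) fun x hx => ⟨hx.1, hx.2, (hc r hr).2⟩
  have i1 := hsl s (left_mem_Icc.2 hst) hys
  have i2 := hsl t (right_mem_Icc.2 hst) hyt
  have i3 : IntervalIntegrable (fun r => k (c - ω * r, 0) * y r 0) volume s t := by
    refine ht0.continuousOn_mul ?_
    rw [uIcc_of_le hst]
    exact hkc.comp (by fun_prop) fun r hr => ⟨le_rfl, (hc r hr).1, (hc r hr).2⟩
  have i4 : κ + ω ≠ 0 →
      IntervalIntegrable (fun r => k (c - ω * r, c - ω * r) * y r (c - ω * r)) volume s t := by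
    intro h
    refine (ht1 h).continuousOn_mul ?_
    rw [uIcc_of_le hst]
    exact hkc.comp (by fun_prop) fun r hr => ⟨(hc r hr).1, le_rfl, (hc r hr).2⟩
  have hsub : trapezoid c ω s t ⊆ Icc 0 τ ×ˢ Icc 0 L :=
    trapezoid_subset hs ht fun r hr => (hc r hr).2
  have hmS := measurableSet_trapezoid c ω s t
  obtain ⟨C, hC, hSC, hCm⟩ := exists_isCompact_superset_trapezoid c ω s t
  have hmaps : MapsTo (fun p : ℝ × ℝ => (c - ω * p.1, p.2)) C (triangle L) := fun p hp =>
    ⟨(hCm p hp).2.1, (hCm p hp).2.2, (hc p.1 (hCm p hp).1).2⟩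
  have hcont : ContinuousOn (fun p : ℝ × ℝ => (c - ω * p.1, p.2)) C := by fun_prop
  have i5 : IntegrableOn (fun p : ℝ × ℝ =>
      (-ω * fderivWithin ℝ k (triangle L) (c - ω * p.1, p.2) (1, 0)
        + κ * fderivWithin ℝ k (triangle L) (c - ω * p.1, p.2) (0, 1)) * y p.1 p.2
        + k (c - ω * p.1, p.2) * f p.1 p.2) (trapezoid c ω s t) := by
    refine Integrable.add ?_ ?_
    · refine integrableOn_continuousOn_mul (hy.mono_set hsub) ?_ hC hmS hSC
      exact (((continuousOn_fderivWithin_triangle hL hk _).comp hcont hmaps).const_mul _).add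
        (((continuousOn_fderivWithin_triangle hL hk _).comp hcont hmaps).const_mul _)
    · exact integrableOn_continuousOn_mul (hf.mono_set hsub) (hkc.comp hcont hmaps)
        hC hmS hSC
  refine ⟨i1, i2, i3, i4, i5, ?_⟩
  refine transport_balance (Y := fun r x => k (c - ω * r, x) * y r x)
    (F := fun r x => (-ω * fderivWithin ℝ k (triangle L) (c - ω * r, x) (1, 0)
        + κ * fderivWithin ℝ k (triangle L) (c - ω * r, x) (0, 1)) * y r x
        + k (c - ω * r, x) * f r x) hκ hst hcs.1 hct.1 i5 i1 i2 i3 i4 ?_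
  filter_upwards [hchar] with b hb s' t' hs' hst' ht' h₁ h₂
  have c₁ := hc s' ⟨hs', hst'.trans ht'⟩
  have c₂ := hc t' ⟨hs'.trans hst', ht'⟩
  exact (isPrimitive_comp_triangle hL hk hst' ⟨h₁.1, h₁.2, c₁.2⟩ ⟨h₂.1, h₂.2, c₂.2⟩).mul
    (hb s' t' (hs.trans hs') hst' (ht'.trans ht) ⟨h₁.1, h₁.2.trans c₁.2⟩
      ⟨h₂.1, h₂.2.trans c₂.2⟩) hst'

/-! ### Free transport of `β` -/

/-- The source term of the `i`-th rightgoing component. -/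
def sourcePlus (P : Plant) (u : ℝ → ℝ → Fin 3 → ℝ) (v : ℝ → ℝ → ℝ) (i : Fin 3) (r x : ℝ) : ℝ :=
  (∑ j, P.Spp x i j * u r x j) + P.Spm x i * v r x

/-- The source term of the leftgoing component. -/
def sourceMinus (P : Plant) (u : ℝ → ℝ → Fin 3 → ℝ) (r x : ℝ) : ℝ :=
  ∑ j, P.Smp x j * u r x j

namespace IsSolution

variable {P : Plant} {T : EReal} {U : ℝ → ℝ} {u : ℝ → ℝ → Fin 3 → ℝ} {v : ℝ → ℝ → ℝ} {τ : ℝ}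
  {K : Fin 3 → ℝ × ℝ → ℝ} {M : ℝ × ℝ → ℝ}

theorem isPrimitive_u (h : IsSolution P T U u v) (hτ : τ ∈ timeDomain T) (i : Fin 3) :
    ∀ᵐ b : ℝ, ∀ s t, 0 ≤ s → s ≤ t → t ≤ τ → b + P.lam i * s ∈ Icc 0 P.L →
      b + P.lam i * t ∈ Icc 0 P.L → IsPrimitive (fun r => u r (b + P.lam i * r) i)
        (fun r => sourcePlus P u v i r (b + P.lam i * r)) s t := by
  filter_upwards [h.char_u i] with b hb s t hs hst ht h₁ h₂
  have hd : ∀ r ∈ Icc s t, r ∈ timeDomain T := fun r hr =>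
    Icc_subset_timeDomain hτ ⟨hs.trans hr.1, hr.2.trans ht⟩
  have hl := (P.lam_pos i).le
  refine ⟨(hb s (hd s (left_mem_Icc.2 hst)) t (hd t (right_mem_Icc.2 hst)) hst h₁ h₂).1,
    fun r hr => ?_⟩
  exact (hb s (hd s (left_mem_Icc.2 hst)) r (hd r hr) hr.1 h₁
    ⟨h₁.1.trans (by nlinarith [hr.1]), le_trans (by nlinarith [hr.2]) h₂.2⟩).2

theorem isPrimitive_v (h : IsSolution P T U u v) (hτ : τ ∈ timeDomain T) :
    ∀ᵐ b : ℝ, ∀ s t, 0 ≤ s → s ≤ t → t ≤ τ → b + -P.lamMinus * s ∈ Icc 0 P.L →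
      b + -P.lamMinus * t ∈ Icc 0 P.L → IsPrimitive (fun r => v r (b + -P.lamMinus * r))
        (fun r => sourceMinus P u r (b + -P.lamMinus * r)) s t := by
  filter_upwards [h.char_v] with b hb s t hs hst ht h₁ h₂
  simp only [neg_mul, ← sub_eq_add_neg] at h₁ h₂ ⊢
  have hd : ∀ r ∈ Icc s t, r ∈ timeDomain T := fun r hr =>
    Icc_subset_timeDomain hτ ⟨hs.trans hr.1, hr.2.trans ht⟩
  have hl := P.lamMinus_pos.le
  refine ⟨(hb s (hd s (left_mem_Icc.2 hst)) t (hd t (right_mem_Icc.2 hst)) hst h₁ h₂).1,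
    fun r hr => ?_⟩
  exact (hb s (hd s (left_mem_Icc.2 hst)) r (hd r hr) hr.1 h₁
    ⟨h₂.1.trans (by nlinarith [hr.2]), le_trans (by nlinarith [hr.1]) h₁.2⟩).2

end IsSolution

theorem isFiniteMeasure_restrict_rect (τ L : ℝ) :
    IsFiniteMeasure ((volume : Measure (ℝ × ℝ)).restrict (Icc 0 τ ×ˢ Icc 0 L)) :=
  isFiniteMeasure_restrict.2 (isCompact_Icc.prod isCompact_Icc).measure_lt_top.ne

theorem integrableOn_rect_mul {τ L : ℝ} {k : ℝ → ℝ} (hk : ContinuousOn k (Icc 0 L))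
    {g : ℝ × ℝ → ℝ} (hg : IntegrableOn g (Icc 0 τ ×ˢ Icc 0 L)) :
    IntegrableOn (fun p : ℝ × ℝ => k p.2 * g p) (Icc 0 τ ×ˢ Icc 0 L) :=
  integrableOn_continuousOn_mul hg (k := fun p : ℝ × ℝ => k p.2)
    (hk.comp continuousOn_snd fun _ hp => hp.2) (isCompact_Icc.prod isCompact_Icc)
    (measurableSet_Icc.prod measurableSet_Icc) Subset.rfl

namespace IsSolution

variable {P : Plant} {T : EReal} {U : ℝ → ℝ} {u : ℝ → ℝ → Fin 3 → ℝ} {v : ℝ → ℝ → ℝ} {τ : ℝ}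
  {K : Fin 3 → ℝ × ℝ → ℝ} {M : ℝ × ℝ → ℝ}

theorem integrableOn_u (h : IsSolution P T U u v) (hτ : τ ∈ timeDomain T) (i : Fin 3) :
    IntegrableOn (fun p : ℝ × ℝ => u p.1 p.2 i) (Icc 0 τ ×ˢ Icc 0 P.L) := by
  have := isFiniteMeasure_restrict_rect τ P.L
  exact (h.memLp_u hτ i).integrable one_le_two

theorem integrableOn_v (h : IsSolution P T U u v) (hτ : τ ∈ timeDomain T) :
    IntegrableOn (fun p : ℝ × ℝ => v p.1 p.2) (Icc 0 τ ×ˢ Icc 0 P.L) := by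
  have := isFiniteMeasure_restrict_rect τ P.L
  exact (h.memLp_v hτ).integrable one_le_two

theorem integrableOn_sourcePlus (h : IsSolution P T U u v) (hτ : τ ∈ timeDomain T) (i : Fin 3) :
    IntegrableOn (fun p : ℝ × ℝ => sourcePlus P u v i p.1 p.2) (Icc 0 τ ×ˢ Icc 0 P.L) :=
  (integrable_finsetSum _ fun j _ =>
    integrableOn_rect_mul (P.Spp_cont i j) (h.integrableOn_u hτ j)).add
    (integrableOn_rect_mul (P.Spm_cont i) (h.integrableOn_v hτ))

theorem integrableOn_sourceMinus (h : IsSolution P T U u v) (hτ : τ ∈ timeDomain T) :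
    IntegrableOn (fun p : ℝ × ℝ => sourceMinus P u p.1 p.2) (Icc 0 τ ×ˢ Icc 0 P.L) :=
  integrable_finsetSum _ fun j _ =>
    integrableOn_rect_mul (P.Smp_cont j) (h.integrableOn_u hτ j)

theorem integrableOn_u_mul_sourcePlus (h : IsSolution P T U u v) (hτ : τ ∈ timeDomain T)
    (i : Fin 3) : IntegrableOn (fun p : ℝ × ℝ => u p.1 p.2 i * sourcePlus P u v i p.1 p.2)
      (Icc 0 τ ×ˢ Icc 0 P.L) := by
  have h1 : IntegrableOn (fun p : ℝ × ℝ => (∑ j, P.Spp p.2 i j * (u p.1 p.2 i * u p.1 p.2 j))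
      + P.Spm p.2 i * (u p.1 p.2 i * v p.1 p.2)) (Icc 0 τ ×ˢ Icc 0 P.L) :=
    (integrable_finsetSum _ fun j _ => integrableOn_rect_mul (P.Spp_cont i j)
      ((h.memLp_u hτ i).integrable_mul (h.memLp_u hτ j))).add
      (integrableOn_rect_mul (P.Spm_cont i) ((h.memLp_u hτ i).integrable_mul (h.memLp_v hτ)))
  refine h1.congr (ae_of_all _ fun p => ?_)
  simp only [sourcePlus, mul_add, Finset.mul_sum]
  congr 1
  · exact Finset.sum_congr rfl fun j _ => by ring
  · ring

theorem integrableOn_slice (h : IsSolution P T U u v) {t : ℝ} (ht : t ∈ timeDomain T) :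
    (∀ i, IntegrableOn (fun x => u t x i) (Ioc 0 P.L)) ∧ IntegrableOn (v t) (Ioc 0 P.L) :=
  ⟨fun i => ((h.inL2 t ht).1 i).integrable one_le_two, (h.inL2 t ht).2.integrable one_le_two⟩

theorem measurable_u_at (h : IsSolution P T U u v) (x : ℝ) (i : Fin 3) :
    Measurable fun r => u r x i :=
  (h.meas_u i).comp (measurable_id.prodMk measurable_const)

theorem measurable_v_at (h : IsSolution P T U u v) (x : ℝ) : Measurable fun r => v r x :=
  h.meas_v.comp (measurable_id.prodMk measurable_const)

/-- The transformed component `β` is constant along almost every leftgoing characteristic. -/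
theorem backstep_const (h : IsSolution P T U u v) (hτ : τ ∈ timeDomain T)
    (hKM : IsBacksteppingKernel P K M) :
    ∀ᵐ c : ℝ, ∀ s t, 0 ≤ s → s ≤ t → t ≤ τ → c - P.lamMinus * s ∈ Icc 0 P.L →
      c - P.lamMinus * t ∈ Icc 0 P.L →
      backstep K M (u t) (v t) (c - P.lamMinus * t) =
        backstep K M (u s) (v s) (c - P.lamMinus * s) := by
  -- The rightgoing components must be integrable along leftgoing lines, where the notion of
  -- solution says nothing separately about each of them. Fubini's theorem supplies this for almost
  -- every label.
  have hline := fun i => ae_integrable_line (F := fun r x => u r x i)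
    (measurableSet_Icc.prod measurableSet_Icc) (h.integrableOn_u hτ i) (-P.lamMinus)
  have hΛ := P.lamMinus_pos
  filter_upwards [h.isPrimitive_v hτ, ae_all_iff.2 hline] with c hc hcl s t hs hst ht hcs hct
  simp only [neg_mul, ← sub_eq_add_neg] at hc hcl
  have hτ0 : ∀ r ∈ Icc s t, r ∈ Icc 0 τ := fun r hr => ⟨hs.trans hr.1, hr.2.trans ht⟩
  have hdom := fun r hr => Icc_subset_timeDomain hτ (hτ0 r hr)
  have hsd := hdom s (left_mem_Icc.2 hst)
  have htd := hdom t (right_mem_Icc.2 hst)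
  have hcm : ∀ r ∈ Icc s t, c - P.lamMinus * r ∈ Icc 0 P.L := fun r hr =>
    ⟨hct.1.trans (by nlinarith [hr.2]), le_trans (by nlinarith [hr.1]) hcs.2⟩
  have hul : ∀ i, IntervalIntegrable (fun r => u r (c - P.lamMinus * r) i) volume s t :=
    fun i => by
      rw [intervalIntegrable_iff_integrableOn_Ioc_of_le hst]
      exact (hcl i).mono_set fun r hr => ⟨hτ0 r (Ioc_subset_Icc_self hr),
        hcm r (Ioc_subset_Icc_self hr)⟩
  have hst_sub : uIcc s t ⊆ uIcc 0 t := by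
    rw [uIcc_of_le hst, uIcc_of_le (hs.trans hst)]
    exact Icc_subset_Icc_left hs
  have hu0 : ∀ i, IntervalIntegrable (fun r => u r 0 i) volume s t := fun i =>
    (intervalIntegrable_of_sq (h.measurable_u_at 0 i) ((h.trace t htd).1 i).1).mono_set hst_sub
  have hv0 : IntervalIntegrable (fun r => v r 0) volume s t :=
    (intervalIntegrable_of_sq (h.measurable_v_at 0) (h.trace t htd).2.1).mono_set hst_sub
  -- The right end follows the characteristic `c - Λ⁻ r`. The component `w⁺_i` crosses it with
  -- relative speed `λ_i + Λ⁻`, while `w⁻` moves with it and has no flux there.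
  have kb := fun i => kernel_balance (κ := P.lam i) (ω := P.lamMinus) (y := fun r x => u r x i)
    (f := sourcePlus P u v i)
    (Or.inl ⟨P.lam_pos i, (add_pos (P.lam_pos i) hΛ).le⟩) hΛ.le P.L_pos hs hst ht hcs hct
    (hKM.K_smooth i) (h.integrableOn_u hτ i) (h.integrableOn_sourcePlus hτ i)
    ((h.integrableOn_slice hsd).1 i) ((h.integrableOn_slice htd).1 i) (hu0 i) (fun _ => hul i)
    (h.isPrimitive_u hτ i)
  have mb := kernel_balance (κ := -P.lamMinus) (ω := P.lamMinus) (y := v)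
    (f := sourceMinus P u)
    (Or.inr ⟨neg_lt_zero.2 hΛ, (neg_add_cancel _).le⟩) hΛ.le P.L_pos hs hst ht hcs hct
    hKM.M_smooth (h.integrableOn_v hτ) (h.integrableOn_sourceMinus hτ)
    (h.integrableOn_slice hsd).2 (h.integrableOn_slice htd).2 hv0
    (fun h => absurd (neg_add_cancel _) h) (h.isPrimitive_v hτ)
  obtain ⟨ms, mt, m0, -, mF, meq⟩ := mb
  choose ks kt k0 k1 kF keq using kb
  have vol : ∀ r, (∀ i, IntervalIntegrable (fun x => K i (c - P.lamMinus * r, x) * u r x i)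
        volume 0 (c - P.lamMinus * r)) →
      IntervalIntegrable (fun x => M (c - P.lamMinus * r, x) * v r x)
        volume 0 (c - P.lamMinus * r) →
      volterra K M (u r) (v r) (c - P.lamMinus * r) =
        (∑ i, ∫ x in (0 : ℝ)..(c - P.lamMinus * r), K i (c - P.lamMinus * r, x) * u r x i)
        + ∫ x in (0 : ℝ)..(c - P.lamMinus * r), M (c - P.lamMinus * r, x) * v r x := by
    intro r h1 h2
    rw [volterra, intervalIntegral.integral_add
      (by simpa only [Finset.sum_fn] using IntervalIntegrable.sum _ fun i _ => h1 i) h2,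
      intervalIntegral.integral_finsetSum fun i _ => h1 i]
  -- The fluxes at `x = 0` cancel, by the kernel condition at `ξ = 0` and `w⁺ = Q w⁻`.
  have e0 : (∑ i, P.lam i * ∫ r in s..t, K i (c - P.lamMinus * r, 0) * u r 0 i)
      = P.lamMinus * ∫ r in s..t, M (c - P.lamMinus * r, 0) * v r 0 := by
    simp only [← intervalIntegral.integral_const_mul]
    rw [← intervalIntegral.integral_finsetSum fun i _ => (k0 i).const_mul _]
    refine intervalIntegral.integral_congr fun r hr => ?_
    rw [uIcc_of_le hst] at hr
    have := hKM.M_bdry _ (hcm r hr)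
    simp only [h.bdry_zero r (hdom r hr)]
    rw [← mul_assoc, this, Finset.sum_mul]
    exact Finset.sum_congr rfl fun i _ => by ring
  -- The diagonal condition on `K` makes the flux through the moving end reproduce the source of
  -- `w⁻`. This is the only change of the Volterra term, so it matches the change of `w⁻`.
  have e1 : (∑ i, (P.lam i + P.lamMinus) *
      ∫ r in s..t, K i (c - P.lamMinus * r, c - P.lamMinus * r) * u r (c - P.lamMinus * r) i)
      = -∫ r in s..t, sourceMinus P u r (c - P.lamMinus * r) := by
    simp only [← intervalIntegral.integral_const_mul]
    rw [← intervalIntegral.integral_finsetSum fun i _ =>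
      (k1 i (add_pos (P.lam_pos i) hΛ).ne').const_mul _, ← intervalIntegral.integral_neg]
    refine intervalIntegral.integral_congr fun r hr => ?_
    rw [uIcc_of_le hst] at hr
    simp only [sourceMinus, ← Finset.sum_neg_distrib]
    refine Finset.sum_congr rfl fun i _ => ?_
    have := hKM.K_diag i _ (hcm r hr)
    linear_combination (u r (c - P.lamMinus * r) i) * this
  have hm := measurableSet_trapezoid c P.lamMinus s t
  -- The interior integrand vanishes pointwise by the two kernel differential equations.
  have eF := integral_add (integrable_finsetSum Finset.univ fun i _ => kF i) mF
  rw [integral_finsetSum Finset.univ fun i _ => kF i, setIntegral_congr_fun (g := fun _ => 0) hm]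
    at eF
  swap
  · intro p hp
    have hp' : (c - P.lamMinus * p.1, p.2) ∈ triangle P.L :=
      ⟨hp.2.1.le, hp.2.2, (hcm p.1 (Ioc_subset_Icc_self hp.1)).2⟩
    have hK := fun i => hKM.K_eq i _ hp'
    have hM := hKM.M_eq _ hp'
    simp only [Fin.sum_univ_three, sourcePlus, sourceMinus] at hK hM ⊢
    linear_combination (-(u p.1 p.2 0)) * hK 0 - u p.1 p.2 1 * hK 1 - u p.1 p.2 2 * hK 2
      - v p.1 p.2 * hM
  have hv := (hc s t hs hst ht hcs hct).integral_eq hst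
  have ekeq := Finset.sum_congr rfl fun i (_ : i ∈ Finset.univ) => keq i
  simp only [Finset.sum_add_distrib, Finset.sum_sub_distrib] at ekeq
  rw [backstep, backstep, vol s ks ms, vol t kt mt]
  simp only [integral_zero] at eF
  rw [neg_add_cancel, zero_mul, sub_zero] at meq
  linarith

end IsSolution

/-! ### Bound of the source terms by `γ V` -/

section SourceBound

variable {P : Plant} {D : Design}

theorem bddAbove_norm_Spp (P : Plant) :
    BddAbove ((fun x => ‖Matrix.toEuclideanCLM (𝕜 := ℝ) (P.Spp x)‖) '' Icc 0 P.L) := by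
  refine isCompact_Icc.bddAbove_image ?_
  have h1 : ContinuousOn P.Spp (Icc 0 P.L) :=
    continuousOn_pi.2 fun i => continuousOn_pi.2 fun j => P.Spp_cont i j
  have h2 : Continuous fun A : Matrix (Fin 3) (Fin 3) ℝ => Matrix.toEuclideanCLM (𝕜 := ℝ) A :=
    LinearMap.continuous_of_finiteDimensional
      (Matrix.toEuclideanCLM (n := Fin 3) (𝕜 := ℝ)).toAlgEquiv.toLinearMap
  exact (h2.comp_continuousOn h1).norm

theorem bddAbove_norm_Spm (P : Plant) :
    BddAbove ((fun x => ‖WithLp.toLp 2 (P.Spm x)‖) '' Icc 0 P.L) := by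
  refine isCompact_Icc.bddAbove_image ?_
  have h1 : ContinuousOn P.Spm (Icc 0 P.L) := continuousOn_pi.2 P.Spm_cont
  exact ((PiLp.continuous_toLp 2 _).comp_continuousOn h1).norm

theorem supSpp_nonneg (P : Plant) : 0 ≤ supSpp P :=
  Real.sSup_nonneg (by rintro _ ⟨x, -, rfl⟩; exact norm_nonneg _)

theorem supSpm_nonneg (P : Plant) : 0 ≤ supSpm P :=
  Real.sSup_nonneg (by rintro _ ⟨x, -, rfl⟩; exact norm_nonneg _)

theorem iInf_lam_pos (P : Plant) : 0 < ⨅ i, P.lam i := by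
  obtain ⟨i, hi⟩ := exists_eq_ciInf_of_finite (f := P.lam)
  exact hi ▸ P.lam_pos i

theorem iSup_A_pos (hA : ∀ i, 0 < D.A i) : 0 < ⨆ i, D.A i :=
  (hA 0).trans_le (le_ciSup (Finite.bddAbove_range D.A) 0)

theorem gammaConst_nonneg (hA : ∀ i, 0 < D.A i) {p₁ p₃ : ℝ} (hp₁ : 0 < p₁) (hp₃ : 0 < p₃) :
    0 ≤ gammaConst P D p₁ p₃ := by
  have h1 := (iSup_A_pos hA).le
  have h2 := (iInf_lam_pos P).le
  have h3 := supSpp_nonneg P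
  have h4 := supSpm_nonneg P
  unfold gammaConst
  positivity

/-- Cauchy–Schwarz for the vector with entries `φ i * a i`, of norm at most `c` times that of `a`:
the sum is twice its inner product with `S a + b s`. The mixed product is bounded by `|a| |b| ≤ |a|²
+ b²`, without the factor one half, in accordance with the form of `γ`. -/
theorem sum_weight_source_le {c : ℝ} (φ a s : Fin 3 → ℝ) (S : Matrix (Fin 3) (Fin 3) ℝ) (b : ℝ)
    (hφ0 : ∀ i, 0 ≤ φ i) (hφ : ∀ i, φ i ≤ c) :
    ∑ i, 2 * φ i * (a i * ((∑ j, S i j * a j) + s i * b)) ≤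
      2 * c * (‖Matrix.toEuclideanCLM (𝕜 := ℝ) S‖ * ∑ i, a i ^ 2
        + ‖WithLp.toLp 2 s‖ * ((∑ i, a i ^ 2) + b ^ 2)) := by
  have hc : 0 ≤ c := (hφ0 0).trans (hφ 0)
  set av : EuclideanSpace ℝ (Fin 3) := WithLp.toLp 2 a with hav
  set fv : EuclideanSpace ℝ (Fin 3) := WithLp.toLp 2 fun i => φ i * a i with hfv
  set sv : EuclideanSpace ℝ (Fin 3) := WithLp.toLp 2 s with hsv
  have nav : ∑ i, a i ^ 2 = ‖av‖ ^ 2 := by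
    rw [EuclideanSpace.real_norm_sq_eq]
  have nfv : ‖fv‖ ≤ c * ‖av‖ := by
    refine abs_le_of_sq_le_sq' ?_ (by positivity) |>.2
    rw [mul_pow, ← nav, EuclideanSpace.real_norm_sq_eq, Finset.mul_sum]
    refine Finset.sum_le_sum fun i _ => ?_
    simp only [hfv, mul_pow]
    gcongr
    · exact hφ0 i
    · exact hφ i
  have h1 : ∑ i, φ i * a i * ∑ j, S i j * a j ≤
      ‖Matrix.toEuclideanCLM (𝕜 := ℝ) S‖ * (c * ‖av‖ ^ 2) := by
    have e : ∑ i, φ i * a i * ∑ j, S i j * a j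
        = inner ℝ (Matrix.toEuclideanCLM (𝕜 := ℝ) S av) fv := by
      simp [PiLp.inner_apply, hfv, hav, Matrix.mulVec, dotProduct]
    rw [e]
    refine (real_inner_le_norm _ _).trans ?_
    calc _ ≤ ‖Matrix.toEuclideanCLM (𝕜 := ℝ) S‖ * ‖av‖ * (c * ‖av‖) := by
          gcongr
          exact ContinuousLinearMap.le_opNorm _ _
      _ = _ := by ring
  have h2 : ∑ i, φ i * a i * s i ≤ ‖sv‖ * (c * ‖av‖) := by
    have e : ∑ i, φ i * a i * s i = inner ℝ sv fv := by
      simp [PiLp.inner_apply, hfv, hsv]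
    rw [e]
    exact (real_inner_le_norm _ _).trans (by gcongr)
  have h2' : -∑ i, φ i * a i * s i ≤ ‖sv‖ * (c * ‖av‖) := by
    have e : ∑ i, φ i * a i * s i = inner ℝ sv fv := by
      simp [PiLp.inner_apply, hfv, hsv]
    rw [e]
    refine (neg_le_abs _).trans ((abs_real_inner_le_norm _ _).trans (by gcongr))
  have h3 : (∑ i, φ i * a i * s i) * b ≤ ‖sv‖ * c * (‖av‖ ^ 2 + b ^ 2) := by
    have hz : |∑ i, φ i * a i * s i| ≤ ‖sv‖ * (c * ‖av‖) := abs_le.2 ⟨by linarith, h2⟩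
    calc _ ≤ |∑ i, φ i * a i * s i| * |b| := by rw [← abs_mul]; exact le_abs_self _
      _ ≤ ‖sv‖ * (c * ‖av‖) * |b| := by gcongr
      _ = ‖sv‖ * c * (‖av‖ * |b|) := by ring
      _ ≤ _ := by
        gcongr
        rw [← sq_abs b]
        nlinarith [sq_nonneg (‖av‖ - |b|), sq_nonneg (‖av‖ + |b|)]
  have e : ∑ i, 2 * φ i * (a i * ((∑ j, S i j * a j) + s i * b)) =
      2 * (∑ i, φ i * a i * ∑ j, S i j * a j) + 2 * ((∑ i, φ i * a i * s i) * b) := by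
    rw [Finset.sum_mul, Finset.mul_sum, Finset.mul_sum, ← Finset.sum_add_distrib]
    exact Finset.sum_congr rfl fun i _ => by ring
  rw [e, nav]
  nlinarith

/-- The weight of the `i`-th rightgoing component in the Lyapunov functional. -/
def weightPlus (P : Plant) (D : Design) (i : Fin 3) (x : ℝ) : ℝ :=
  D.A i / P.lam i * Real.exp (-(D.μ * x / P.lam i))

/-- The weight of the leftgoing component in the Lyapunov functional. -/
def weightMinus (P : Plant) (D : Design) (x : ℝ) : ℝ :=
  D.B / P.lamMinus * Real.exp (D.μ * x / P.lamMinus)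

theorem hasDerivAt_weightPlus (P : Plant) (D : Design) (i : Fin 3) (x : ℝ) :
    HasDerivAt (weightPlus P D i) (-(D.μ / P.lam i) * weightPlus P D i x) x := by
  have : HasDerivAt (fun x => -(D.μ * x / P.lam i)) (-(D.μ / P.lam i)) x := by
    simpa using (((hasDerivAt_id x).const_mul D.μ).div_const (P.lam i)).fun_neg
  exact ((this.exp).const_mul (D.A i / P.lam i)).congr_deriv (by simp only [weightPlus]; ring)

theorem hasDerivAt_weightMinus (P : Plant) (D : Design) (x : ℝ) :
    HasDerivAt (weightMinus P D) (D.μ / P.lamMinus * weightMinus P D x) x := by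
  have : HasDerivAt (fun x => D.μ * x / P.lamMinus) (D.μ / P.lamMinus) x := by
    simpa using ((hasDerivAt_id x).const_mul D.μ).div_const P.lamMinus
  exact ((this.exp).const_mul (D.B / P.lamMinus)).congr_deriv
    (by simp only [weightMinus]; ring)

theorem continuous_weightPlus (P : Plant) (D : Design) (i : Fin 3) :
    Continuous (weightPlus P D i) :=
  continuous_iff_continuousAt.2 fun x => (hasDerivAt_weightPlus P D i x).continuousAt

theorem continuous_weightMinus (P : Plant) (D : Design) : Continuous (weightMinus P D) :=
  continuous_iff_continuousAt.2 fun x => (hasDerivAt_weightMinus P D x).continuousAt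

theorem weightPlus_nonneg (hA : ∀ i, 0 < D.A i) (i : Fin 3) (x : ℝ) : 0 ≤ weightPlus P D i x :=
  mul_nonneg (div_nonneg (hA i).le (P.lam_pos i).le) (Real.exp_pos _).le

theorem weightPlus_le (hA : ∀ i, 0 < D.A i) (hμ : 0 < D.μ) (i : Fin 3) {x : ℝ} (hx : 0 ≤ x) :
    weightPlus P D i x ≤ (⨆ i, D.A i) / ⨅ i, P.lam i := by
  have h1 : D.A i / P.lam i ≤ (⨆ i, D.A i) / ⨅ i, P.lam i :=
    div_le_div₀ (iSup_A_pos hA).le (le_ciSup (Finite.bddAbove_range D.A) i) (iInf_lam_pos P)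
      (ciInf_le (Finite.bddBelow_range P.lam) i)
  have h2 : Real.exp (-(D.μ * x / P.lam i)) ≤ 1 := by
    rw [Real.exp_le_one_iff]
    have := P.lam_pos i
    have : 0 ≤ D.μ * x / P.lam i := by positivity
    linarith
  exact (mul_le_of_le_one_right (div_nonneg (hA i).le (P.lam_pos i).le) h2).trans h1

theorem integrableOn_Icc_mul {L : ℝ} {k g : ℝ → ℝ} (hk : ContinuousOn k (Icc 0 L))
    (hg : IntegrableOn g (Ioc 0 L)) : IntegrableOn (fun x => k x * g x) (Ioc 0 L) :=
  integrableOn_continuousOn_mul hg hk isCompact_Icc measurableSet_Ioc Ioc_subset_Icc_self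

theorem integrableOn_weight_source (P : Plant) (D : Design) {a : ℝ → Fin 3 → ℝ} {b : ℝ → ℝ}
    (hab : InL2 P.L a b) :
    IntegrableOn (fun x => ∑ i, 2 * weightPlus P D i x *
      (a x i * ((∑ j, P.Spp x i j * a x j) + P.Spm x i * b x))) (Ioc 0 P.L) := by
  refine integrable_finsetSum _ fun i _ => ?_
  refine integrableOn_Icc_mul (k := fun x => 2 * weightPlus P D i x)
    ((continuous_weightPlus P D i).const_mul 2).continuousOn ?_
  have h1 : IntegrableOn (fun x => (∑ j, P.Spp x i j * (a x i * a x j))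
      + P.Spm x i * (a x i * b x)) (Ioc 0 P.L) :=
    (integrable_finsetSum _ fun j _ => integrableOn_Icc_mul (P.Spp_cont i j)
      ((hab.1 i).integrable_mul (hab.1 j))).add
      (integrableOn_Icc_mul (P.Spm_cont i) ((hab.1 i).integrable_mul hab.2))
  refine h1.congr (ae_of_all _ fun x => ?_)
  simp only [mul_add, Finset.mul_sum]
  congr 1
  · exact Finset.sum_congr rfl fun j _ => by ring
  · ring

/-- The indefinite part of the derivative of the Lyapunov functional is dominated by `γ V`. -/
theorem integral_weight_source_le (hA : ∀ i, 0 < D.A i) (hμ : 0 < D.μ) {p₁ p₃ p₄ : ℝ}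
    (hp₁ : 0 < p₁) (hp₃ : 0 < p₃) (hp₃₄ : LyapunovBounds P D p₃ p₄)
    {a : ℝ → Fin 3 → ℝ} {b β : ℝ → ℝ} (hab : InL2 P.L a b) (haβ : InL2 P.L a β)
    (hle : p₁ * normSq P.L a b ≤ normSq P.L a β) :
    ∫ x in Ioc 0 P.L, ∑ i, 2 * weightPlus P D i x *
        (a x i * ((∑ j, P.Spp x i j * a x j) + P.Spm x i * b x)) ≤
      gammaConst P D p₁ p₃ * lyapunov P D a β := by
  set c := (⨆ i, D.A i) / ⨅ i, P.lam i with hc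
  have hc0 : 0 ≤ c := div_nonneg (iSup_A_pos hA).le (iInf_lam_pos P).le
  have hn : ∀ {β : ℝ → ℝ}, normSq P.L a β = ∫ x in Ioc 0 P.L, ((∑ i, a x i ^ 2) + β x ^ 2) :=
    intervalIntegral.integral_of_le P.L_pos.le
  have hS0 := supSpp_nonneg P
  have hs0 := supSpm_nonneg P
  -- The `Σ⁺⁺` part involves only `w⁺ = α` and is measured by `ϑ` at no cost. The `Σ⁺⁻` part
  -- contains `w⁻`, so it is measured by `w` and later pays a factor depending on `p₁`.
  have h1 : ∫ x in Ioc 0 P.L, ∑ i, 2 * weightPlus P D i x *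
        (a x i * ((∑ j, P.Spp x i j * a x j) + P.Spm x i * b x)) ≤
      2 * c * (supSpp P * normSq P.L a β + supSpm P * normSq P.L a b) := by
    rw [hn, hn, ← integral_const_mul, ← integral_const_mul,
      ← integral_add (haβ.integrableOn_sq.const_mul _) (hab.integrableOn_sq.const_mul _),
      ← integral_const_mul]
    refine integral_mono_ae (integrableOn_weight_source P D hab)
      (((haβ.integrableOn_sq.const_mul _).add (hab.integrableOn_sq.const_mul _)).const_mul _) ?_
    filter_upwards [ae_restrict_mem measurableSet_Ioc] with x hx
    have hx' := Ioc_subset_Icc_self hx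
    refine (sum_weight_source_le (fun i => weightPlus P D i x) (a x) (P.Spm x) (P.Spp x) (b x)
      (fun i => weightPlus_nonneg hA i x) (fun i => weightPlus_le hA hμ i hx.1.le)).trans ?_
    gcongr
    · exact le_csSup (bddAbove_norm_Spp P) (mem_image_of_mem _ hx')
    · exact le_add_of_nonneg_right (sq_nonneg _)
    · exact le_csSup (bddAbove_norm_Spm P) (mem_image_of_mem _ hx')
  have hnn := normSq_nonneg P.L_pos.le a β
  -- The factor `1 / p₁` would suffice; the extra `1` is slack already present in `γ`.
  have h2 : normSq P.L a b ≤ (1 + 1 / p₁) * normSq P.L a β := by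
    have : normSq P.L a b ≤ 1 / p₁ * normSq P.L a β := by
      rw [one_div, ← div_eq_inv_mul, le_div_iff₀ hp₁]
      linarith
    linarith
  calc _ ≤ _ := h1
    _ ≤ 2 * c * (supSpp P * normSq P.L a β + supSpm P * ((1 + 1 / p₁) * normSq P.L a β)) := by
        gcongr
    _ = gammaConst P D p₁ p₃ * (p₃ * normSq P.L a β) := by
        have := (iInf_lam_pos P).ne'
        rw [gammaConst, hc]
        field_simp
    _ ≤ _ := mul_le_mul_of_nonneg_left (hp₃₄ a β haβ).1 (gammaConst_nonneg hA hp₁ hp₃)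

end SourceBound

/-! ### Evolution of the Lyapunov functional -/

/-- The time derivative of the Lyapunov functional along a solution. -/
def lyapunovRate (P : Plant) (D : Design) (K : Fin 3 → ℝ × ℝ → ℝ) (M : ℝ × ℝ → ℝ)
    (u : ℝ → ℝ → Fin 3 → ℝ) (v : ℝ → ℝ → ℝ) (r : ℝ) : ℝ :=
  (∑ i, (D.A i * u r 0 i ^ 2 - D.A i * Real.exp (-(D.μ * P.L / P.lam i)) * u r P.L i ^ 2))
    + (D.B * Real.exp (D.μ * P.L / P.lamMinus) * backstep K M (u r) (v r) P.L ^ 2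
      - D.B * v r 0 ^ 2)
    + ∫ x in Ioc 0 P.L, ((∑ i, (-D.μ * weightPlus P D i x * u r x i ^ 2
        + 2 * weightPlus P D i x * (u r x i * sourcePlus P u v i r x)))
      + -D.μ * weightMinus P D x * backstep K M (u r) (v r) x ^ 2)

theorem backstep_zero (K : Fin 3 → ℝ × ℝ → ℝ) (M : ℝ × ℝ → ℝ) (a : ℝ → Fin 3 → ℝ) (b : ℝ → ℝ) :
    backstep K M a b 0 = b 0 := by
  simp [backstep, volterra]

theorem lyapunov_eq_sum (P : Plant) (D : Design) {a : ℝ → Fin 3 → ℝ} {β : ℝ → ℝ}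
    (h : InL2 P.L a β) : lyapunov P D a β =
      (∑ i, ∫ x in (0 : ℝ)..P.L, weightPlus P D i x * a x i ^ 2)
        + ∫ x in (0 : ℝ)..P.L, weightMinus P D x * β x ^ 2 := by
  have h1 : ∀ i, IntervalIntegrable (fun x => weightPlus P D i x * a x i ^ 2) volume 0 P.L :=
    fun i => (intervalIntegrable_iff_integrableOn_Ioc_of_le P.L_pos.le).2
      (integrableOn_Icc_mul (continuous_weightPlus P D i).continuousOn (h.1 i).integrable_sq)
  have h2 : IntervalIntegrable (fun x => weightMinus P D x * β x ^ 2) volume 0 P.L :=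
    (intervalIntegrable_iff_integrableOn_Ioc_of_le P.L_pos.le).2
      (integrableOn_Icc_mul (continuous_weightMinus P D).continuousOn h.2.integrable_sq)
  rw [← intervalIntegral.integral_finsetSum fun i _ => h1 i, ← intervalIntegral.integral_add
    (by simpa only [Finset.sum_fn] using IntervalIntegrable.sum _ fun i _ => h1 i) h2]
  rfl

namespace IsSolution

variable {P : Plant} {D : Design} {T : EReal} {U : ℝ → ℝ} {u : ℝ → ℝ → Fin 3 → ℝ}
  {v : ℝ → ℝ → ℝ} {τ : ℝ} {K : Fin 3 → ℝ × ℝ → ℝ} {M : ℝ × ℝ → ℝ}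

theorem intervalIntegrable_backstep_L (h : IsSolution P T U u v) (hτ : τ ∈ timeDomain T)
    (hK : ∀ i, ContinuousOn (K i) (triangle P.L)) (hM : ContinuousOn M (triangle P.L)) :
    IntervalIntegrable (fun r => backstep K M (u r) (v r) P.L ^ 2) volume 0 τ := by
  obtain ⟨C, hC⟩ := h.exists_abs_volterra_le hτ hK hM
  obtain ⟨Φ, hΦ, hΦe⟩ := exists_measurable_volterra P.L_pos.le hK hM h.meas_u h.meas_v
  have hLm : P.L ∈ Icc 0 P.L := right_mem_Icc.2 P.L_pos.le
  have h1 : MemLp (fun r => v r P.L) 2 (volume.restrict (Ioc 0 τ)) := by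
    rw [memLp_two_iff_integrable_sq (h.measurable_v_at P.L).aestronglyMeasurable]
    exact (intervalIntegrable_iff_integrableOn_Ioc_of_le hτ.1).1 (h.trace τ hτ).2.2
  have h2 : MemLp (fun r => volterra K M (u r) (v r) P.L) 2 (volume.restrict (Ioc 0 τ)) := by
    refine MemLp.of_bound ?_ C ?_
    · have : Measurable fun r => Φ (r, P.L) := hΦ.comp (measurable_id.prodMk measurable_const)
      exact this.aestronglyMeasurable.congr (ae_of_all _ fun r => (hΦe r P.L hLm).symm)
    · filter_upwards [ae_restrict_mem measurableSet_Ioc] with r hr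
      exact hC r (Ioc_subset_Icc_self hr) P.L hLm
  exact (intervalIntegrable_iff_integrableOn_Ioc_of_le hτ.1).2 (h1.sub h2).integrable_sq

/-- The sum of four energy balances. The weights satisfy `λ_i φ_i' = -μ φ_i` and `-Λ⁻ φ' = -μ φ`,
which yields the damping `-μ V`; their boundary values times the speeds are the coefficients of the
traces. The equation for `β` has zero source. -/
theorem lyapunov_balance (h : IsSolution P T U u v) (hτ : τ ∈ timeDomain T)
    (hKM : IsBacksteppingKernel P K M) :
    IntervalIntegrable (lyapunovRate P D K M u v) volume 0 τ ∧
    lyapunov P D (u τ) (backstep K M (u τ) (v τ)) =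
      lyapunov P D (u 0) (backstep K M (u 0) (v 0))
        + ∫ r in (0 : ℝ)..τ, lyapunovRate P D K M u v r := by
  have hKc := fun i => (hKM.K_smooth i).continuousOn
  have hMc := hKM.M_smooth.continuousOn
  have h0 : (0 : ℝ) ∈ timeDomain T := Icc_subset_timeDomain hτ (left_mem_Icc.2 hτ.1)
  have ub := fun i => energy_balance (κ := P.lam i) (y := fun r x => u r x i)
    (f := sourcePlus P u v i) (P.lam_pos i).ne' hτ.1 P.L_pos.le (hasDerivAt_weightPlus P D i)
    ((continuous_weightPlus P D i).const_mul _) (h.memLp_u hτ i)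
    (h.integrableOn_u_mul_sourcePlus hτ i) ((h.inL2 0 h0).1 i) ((h.inL2 τ hτ).1 i)
    ((h.trace τ hτ).1 i).1 ((h.trace τ hτ).1 i).2 (h.isPrimitive_u hτ i)
  have b0 : IntervalIntegrable (fun r => backstep K M (u r) (v r) 0 ^ 2) volume 0 τ := by
    simp only [backstep_zero]
    exact (h.trace τ hτ).2.1
  have bL := h.intervalIntegrable_backstep_L hτ hKc hMc
  have bb := energy_balance (κ := -P.lamMinus) (y := fun r x => backstep K M (u r) (v r) x)
    (f := fun _ _ => 0) (neg_ne_zero.2 P.lamMinus_pos.ne') hτ.1 P.L_pos.le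
    (hasDerivAt_weightMinus P D) ((continuous_weightMinus P D).const_mul _)
    (h.memLp_backstep hτ hKc hMc) (by simp) (h.inL2_backstep h0 hKc hMc).2
    (h.inL2_backstep hτ hKc hMc).2 b0 bL (by
      filter_upwards [h.backstep_const hτ hKM] with c hc s t hs hst ht h₁ h₂
      simp only [neg_mul, ← sub_eq_add_neg] at h₁ h₂ ⊢
      refine (IsPrimitive.const (backstep K M (u s) (v s) (c - P.lamMinus * s)) s t).congr hst
        (fun r hr => (hc s r hs hr.1 (hr.2.trans ht) h₁ ⟨h₂.1.trans ?_, le_trans ?_ h₁.2⟩).symm)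
        fun _ _ => rfl
      · nlinarith [hr.2, P.lamMinus_pos]
      · nlinarith [hr.1, P.lamMinus_pos])
  choose uF ueq using ub
  obtain ⟨bF, beq⟩ := bb
  have cu : ∀ i, P.lam i * (-(D.μ / P.lam i)) = -D.μ := fun i => by
    have := (P.lam_pos i).ne'
    field_simp
  have cb : -P.lamMinus * (D.μ / P.lamMinus) = -D.μ := by
    have := P.lamMinus_pos.ne'
    field_simp
  simp only [← mul_assoc (P.lam _), cu] at uF ueq
  simp only [← mul_assoc (-P.lamMinus), cb, mul_zero, add_zero] at bF beq
  have hHF := Integrable.add (integrable_finsetSum Finset.univ fun i _ => uF i) bF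
  have hHI := integral_add (integrable_finsetSum Finset.univ fun i _ => uF i) bF
  rw [integral_finsetSum Finset.univ fun i _ => uF i] at hHI
  rw [Measure.volume_eq_prod] at hHF hHI
  rw [setIntegral_prod _ (by exact hHF), ← Measure.volume_eq_prod] at hHI
  rw [← Measure.prod_restrict] at hHF
  have hin := (intervalIntegrable_iff_integrableOn_Ioc_of_le hτ.1).2 hHF.integral_prod_left
  rw [← intervalIntegral.integral_of_le hτ.1] at hHI
  have j0 := fun i => ((h.trace τ hτ).1 i).1.const_mul (D.A i)
  have j1 := fun i => ((h.trace τ hτ).1 i).2.const_mul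
    (D.A i * Real.exp (-(D.μ * P.L / P.lam i)))
  have jb0 := (h.trace τ hτ).2.1.const_mul D.B
  have jbL := bL.const_mul (D.B * Real.exp (D.μ * P.L / P.lamMinus))
  have js : IntervalIntegrable (fun r => ∑ i, (D.A i * u r 0 i ^ 2
      - D.A i * Real.exp (-(D.μ * P.L / P.lam i)) * u r P.L i ^ 2)) volume 0 τ := by
    simpa only [Finset.sum_fn] using IntervalIntegrable.sum Finset.univ
      fun i _ => (j0 i).sub (j1 i)
  have jr : IntervalIntegrable (lyapunovRate P D K M u v) volume 0 τ :=
    (js.add (jbL.sub jb0)).add hin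
  refine ⟨jr, ?_⟩
  have eint : ∫ r in (0 : ℝ)..τ, lyapunovRate P D K M u v r = _ :=
    intervalIntegral.integral_add (js.add (jbL.sub jb0)) hin
  rw [intervalIntegral.integral_add js (jbL.sub jb0),
    intervalIntegral.integral_finsetSum fun i _ => (j0 i).sub (j1 i),
    intervalIntegral.integral_sub jbL jb0] at eint
  simp only [fun i => intervalIntegral.integral_sub (j0 i) (j1 i),
    intervalIntegral.integral_const_mul] at eint
  have w0 : ∀ i, P.lam i * weightPlus P D i 0 = D.A i := fun i => by
    have := (P.lam_pos i).ne'
    simp only [weightPlus, mul_zero, zero_div, neg_zero, Real.exp_zero]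
    field_simp
  have wL : ∀ i, P.lam i * weightPlus P D i P.L =
      D.A i * Real.exp (-(D.μ * P.L / P.lam i)) := fun i => by
    have := (P.lam_pos i).ne'
    simp only [weightPlus]
    field_simp
  have z0 : P.lamMinus * weightMinus P D 0 = D.B := by
    have := P.lamMinus_pos.ne'
    simp only [weightMinus, mul_zero, zero_div, Real.exp_zero]
    field_simp
  have zL : P.lamMinus * weightMinus P D P.L =
      D.B * Real.exp (D.μ * P.L / P.lamMinus) := by
    have := P.lamMinus_pos.ne'
    simp only [weightMinus]
    field_simp
  simp only [intervalIntegral.integral_const_mul, ← mul_assoc (P.lam _), w0, wL] at ueq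
  simp only [intervalIntegral.integral_const_mul, ← mul_assoc (-P.lamMinus), neg_mul P.lamMinus,
    z0, zL, backstep_zero] at beq
  have usum := Finset.sum_congr rfl fun i (_ : i ∈ Finset.univ) => ueq i
  simp only [Finset.sum_add_distrib, Finset.sum_sub_distrib] at usum
  simp only [Finset.sum_sub_distrib] at eint
  dsimp only at hHI
  rw [lyapunov_eq_sum P D (h.inL2_backstep hτ hKc hMc),
    lyapunov_eq_sum P D (h.inL2_backstep h0 hKc hMc), eint]
  linarith

end IsSolution

namespace IsSolution

variable {P : Plant} {D : Design} {T : EReal} {U : ℝ → ℝ} {u : ℝ → ℝ → Fin 3 → ℝ}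
  {v : ℝ → ℝ → ℝ} {τ : ℝ} {K : Fin 3 → ℝ × ℝ → ℝ} {M : ℝ × ℝ → ℝ}

theorem isPrimitive_lyapunov (h : IsSolution P T U u v) (hτ : τ ∈ timeDomain T)
    (hKM : IsBacksteppingKernel P K M) :
    IsPrimitive (fun t => lyapunov P D (u t) (backstep K M (u t) (v t)))
      (lyapunovRate P D K M u v) 0 τ :=
  ⟨(h.lyapunov_balance hτ hKM).1, fun _ hr =>
    (h.lyapunov_balance (Icc_subset_timeDomain hτ hr) hKM).2⟩

/-- The boundary condition at `x = 0` expresses the inflow of `w⁺` through the trace of `w⁻`, and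
the only term of indefinite sign in the interior is bounded by `γ V`. -/
theorem lyapunovRate_le (h : IsSolution P T U u v) (hτ : τ ∈ timeDomain T)
    (hKM : IsBacksteppingKernel P K M) (hA : ∀ i, 0 < D.A i) (hμ : 0 < D.μ) {p₁ p₂ p₃ p₄ : ℝ}
    (hp₁ : 0 < p₁) (hp₃ : 0 < p₃) (hp₁₂ : TransformBounds P K M p₁ p₂)
    (hp₃₄ : LyapunovBounds P D p₃ p₄) :
    lyapunovRate P D K M u v τ ≤
      (∑ i, (D.A i * P.Q i ^ 2 * v τ 0 ^ 2
        - D.A i * Real.exp (-(D.μ * P.L / P.lam i)) * u τ P.L i ^ 2))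
      + (D.B * Real.exp (D.μ * P.L / P.lamMinus) * backstep K M (u τ) (v τ) P.L ^ 2
        - D.B * v τ 0 ^ 2)
      - (D.μ - gammaConst P D p₁ p₃) * lyapunov P D (u τ) (backstep K M (u τ) (v τ)) := by
  have hw := h.inL2 τ hτ
  have hϑ := h.inL2_backstep hτ (fun i => (hKM.K_smooth i).continuousOn) hKM.M_smooth.continuousOn
  have h1 := integral_weight_source_le hA hμ hp₁ hp₃ hp₃₄ hw hϑ (hp₁₂ _ _ hw).1
  have i1 : IntegrableOn (fun x => (∑ i, weightPlus P D i x * u τ x i ^ 2)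
      + weightMinus P D x * backstep K M (u τ) (v τ) x ^ 2) (Ioc 0 P.L) :=
    (integrable_finsetSum _ fun i _ => integrableOn_Icc_mul
      (continuous_weightPlus P D i).continuousOn (hϑ.1 i).integrable_sq).add
      (integrableOn_Icc_mul (continuous_weightMinus P D).continuousOn hϑ.2.integrable_sq)
  have eV : lyapunov P D (u τ) (backstep K M (u τ) (v τ)) =
      ∫ x in Ioc 0 P.L, ((∑ i, weightPlus P D i x * u τ x i ^ 2)
        + weightMinus P D x * backstep K M (u τ) (v τ) x ^ 2) :=
    intervalIntegral.integral_of_le P.L_pos.le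
  have e : ∫ x in Ioc 0 P.L, ((∑ i, (-D.μ * weightPlus P D i x * u τ x i ^ 2
        + 2 * weightPlus P D i x * (u τ x i * sourcePlus P u v i τ x)))
      + -D.μ * weightMinus P D x * backstep K M (u τ) (v τ) x ^ 2) =
      -D.μ * lyapunov P D (u τ) (backstep K M (u τ) (v τ)) +
      ∫ x in Ioc 0 P.L, ∑ i, 2 * weightPlus P D i x *
        (u τ x i * ((∑ j, P.Spp x i j * u τ x j) + P.Spm x i * v τ x)) := by
    rw [eV, ← integral_const_mul, ← integral_add (i1.const_mul _)
      (integrableOn_weight_source P D hw)]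
    refine integral_congr_ae (ae_of_all _ fun x => ?_)
    simp only [sourcePlus, Finset.sum_add_distrib, mul_add (-D.μ), Finset.mul_sum, mul_assoc]
    ring
  rw [lyapunovRate, e]
  have e2 : ∀ i, D.A i * u τ 0 i ^ 2 = D.A i * P.Q i ^ 2 * v τ 0 ^ 2 := fun i => by
    rw [h.bdry_zero τ hτ]
    ring
  simp only [e2]
  linarith

end IsSolution

/-! ### The triggering mechanism and the decay of `V - m` -/

namespace IsClosedLoop

variable {P : Plant} {D : Design} {K : Fin 3 → ℝ × ℝ → ℝ} {M : ℝ × ℝ → ℝ}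
  {G : Fin 3 → ℝ × ℝ → ℝ} {N : ℝ × ℝ → ℝ} {u : ℝ → ℝ → Fin 3 → ℝ} {v : ℝ → ℝ → ℝ}
  {Ud m : ℝ → ℝ} {tk : ℕ → EReal} {τ : ℝ}

theorem isPrimitive_m (h : IsClosedLoop P D K M G N u v Ud m tk)
    (hτ : τ ∈ timeDomain (⨆ k, tk k)) :
    IsPrimitive m (fun s => mRate P D (m s) (Ud s - feedback P K M G N (u s) (v s))
      (lyapunov P D (u s) (backstep K M (u s) (v s))) (u s P.L)
      (backstep K M (u s) (v s) 0)) 0 τ :=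
  ⟨(h.m_eq τ hτ).1, fun r hr => (h.m_eq r (Icc_subset_timeDomain hτ hr)).2⟩

/-- At the boundary, `β` is the deviation of the applied input from the continuous feedback. -/
theorem backstep_L (h : IsClosedLoop P D K M G N u v Ud m tk) (hGN : IsInverseKernel P K M G N)
    (hτ : τ ∈ timeDomain (⨆ k, tk k)) :
    backstep K M (u τ) (v τ) P.L = Ud τ - feedback P K M G N (u τ) (v τ) := by
  have h1 := hGN.left_inv _ _ (h.solution.inL2 τ hτ) P.L (right_mem_Icc.2 P.L_pos.le)
  have h2 := h.solution.bdry_L τ hτ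
  rw [invBackstep] at h1
  rw [feedback]
  linarith

/-- Away from the execution times the triggering inequality fails. -/
theorem not_triggered (h : IsClosedLoop P D K M G N u v Ud m tk)
    (hτ : τ ∈ timeDomain (⨆ k, tk k)) (hne : ∀ k, (τ : EReal) ≠ tk k) :
    ¬ Triggered P D (Ud τ - feedback P K M G N (u τ) (v τ))
      (lyapunov P D (u τ) (backstep K M (u τ) (v τ))) (m τ) := by
  obtain ⟨k, hk1, hk2⟩ : ∃ k, tk k < (τ : EReal) ∧ (τ : EReal) < tk (k + 1) := by
    classical
    have hex : ∃ n, (τ : EReal) < tk n := lt_iSup_iff.1 hτ.2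
    -- The first execution time beyond `τ` is not `tk 0 = 0`, so it has a predecessor; the input in
    -- force at `τ` was sampled there.
    have hpos : Nat.find hex ≠ 0 := by
      intro h0
      have := Nat.find_spec hex
      rw [h0, h.time_zero] at this
      exact absurd hτ.1 (not_le.2 (EReal.coe_lt_coe_iff.1 this))
    obtain ⟨k, hk⟩ := Nat.exists_eq_succ_of_ne_zero hpos
    refine ⟨k, lt_of_le_of_ne (not_lt.1 (Nat.find_min hex (by omega))) (hne k).symm, ?_⟩
    rw [← Nat.succ_eq_add_one, ← hk]
    exact Nat.find_spec hex
  rw [h.hold k τ hk1.le hk2]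
  intro htr
  refine hk2.not_ge ?_
  rw [h.next k]
  exact sInf_le ⟨τ, ⟨hk1, htr⟩, rfl⟩

/-- The execution times form a countable, hence null, set, so differential inequalities for `m` may
ignore them. -/
theorem ae_not_triggered (h : IsClosedLoop P D K M G N u v Ud m tk) :
    ∀ᵐ r : ℝ, r ∈ timeDomain (⨆ k, tk k) →
      ¬ Triggered P D (Ud r - feedback P K M G N (u r) (v r))
        (lyapunov P D (u r) (backstep K M (u r) (v r))) (m r) := by
  have hc : (range fun k => (tk k).toReal).Countable := countable_range _
  filter_upwards [hc.ae_notMem volume] with r hr hrd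
  refine h.not_triggered hrd fun k hk => hr ⟨k, ?_⟩
  simp [← hk]

/-- The auxiliary variable stays negative. -/
theorem m_neg (h : IsClosedLoop P D K M G N u v Ud m tk) (hζ : 0 < D.ζ)
    (hς : ∀ i, D.ς i ∈ Ioo (0 : ℝ) 1) (hς₄ : D.ς₄ ∈ Ioo (0 : ℝ) 1)
    (hτ : τ ∈ timeDomain (⨆ k, tk k)) : m τ < 0 := by
  -- The failed trigger gives `B e^{μL/Λ⁻} d² < σ μ V - m / ζ`, which accounts for the `1 / ζ` in
  -- the rate; the trace terms only lower the derivative.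
  have h1 := (h.isPrimitive_m hτ).le_exp_mul hτ.1 (κ := D.η + 1 / D.ζ) (by
    filter_upwards [h.ae_not_triggered] with r hr hrm
    have hn := hr (Icc_subset_timeDomain hτ (Ioc_subset_Icc_self hrm))
    rw [Triggered, ge_iff_le, not_le] at hn
    set d := Ud r - feedback P K M G N (u r) (v r)
    set V := lyapunov P D (u r) (backstep K M (u r) (v r))
    have hb : D.B * Real.exp (D.μ * P.L / P.lamMinus) * d ^ 2 ≤
        D.σ * D.μ * V - 1 / D.ζ * m r := by
      have : D.ζ * (D.B * Real.exp (D.μ * P.L / P.lamMinus) * d ^ 2) ≤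
          D.ζ * (D.σ * D.μ * V - 1 / D.ζ * m r) := by
        have e : D.ζ * (D.σ * D.μ * V - 1 / D.ζ * m r) = D.ζ * D.μ * D.σ * V - m r := by
          field_simp
        rw [e]
        linarith
      exact le_of_mul_le_mul_left this hζ
    have h2 : 0 ≤ ∑ i, D.ς i * u r P.L i ^ 2 :=
      Finset.sum_nonneg fun i _ => mul_nonneg (hς i).1.le (sq_nonneg _)
    have h3 : 0 ≤ D.ς₄ * backstep K M (u r) (v r) 0 ^ 2 := mul_nonneg hς₄.1.le (sq_nonneg _)
    rw [mRate]
    linarith)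
  exact h1.trans_lt (mul_neg_of_pos_of_neg (Real.exp_pos _) h.m_zero)

/-- Exponential decay of `V - m`, at any rate not exceeding the two natural ones. -/
theorem lyapunov_sub_m_le (h : IsClosedLoop P D K M G N u v Ud m tk)
    (hKM : IsBacksteppingKernel P K M) (hGN : IsInverseKernel P K M G N)
    (hA : ∀ i, 0 < D.A i) (hμ : 0 < D.μ) (hζ : 0 < D.ζ)
    (hς : ∀ i, D.ς i ∈ Ioo (0 : ℝ) 1) (hς₄ : D.ς₄ ∈ Ioo (0 : ℝ) 1)
    (hsel : ∀ i, D.ς i - D.A i * Real.exp (-(D.μ * P.L / P.lam i)) ≤ 0)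
    (hsel₄ : D.ς₄ + (∑ i, D.A i * P.Q i ^ 2) - D.B ≤ 0)
    {p₁ p₂ p₃ p₄ κ : ℝ} (hp₁ : 0 < p₁) (hp₃ : 0 < p₃)
    (hp₁₂ : TransformBounds P K M p₁ p₂) (hp₃₄ : LyapunovBounds P D p₃ p₄)
    (hκ₁ : κ ≤ decayRate P D p₁ p₃) (hκ₂ : κ ≤ D.η) (hτ : τ ∈ timeDomain (⨆ k, tk k)) :
    lyapunov P D (u τ) (backstep K M (u τ) (v τ)) - m τ ≤
      Real.exp (-κ * τ) * (lyapunov P D (u 0) (backstep K M (u 0) (v 0)) - m 0) := by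
  have hp := (h.solution.isPrimitive_lyapunov (D := D) hτ hKM).add
    ((h.isPrimitive_m hτ).const_mul (-1))
  have h1 := hp.le_exp_mul hτ.1 (κ := κ) (ae_of_all _ fun r hr => by
    have hrd := Icc_subset_timeDomain hτ (Ioc_subset_Icc_self hr)
    have h2 := h.solution.lyapunovRate_le hrd hKM hA hμ hp₁ hp₃ hp₁₂ hp₃₄
    have h3 := h.m_neg hζ hς hς₄ hrd
    have hϑ := h.solution.inL2_backstep hrd (fun i => (hKM.K_smooth i).continuousOn)
      hKM.M_smooth.continuousOn
    have hV : 0 ≤ lyapunov P D (u r) (backstep K M (u r) (v r)) :=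
      (mul_nonneg hp₃.le (normSq_nonneg P.L_pos.le _ _)).trans (hp₃₄ _ _ hϑ).1
    -- After this substitution the `d²` terms in the derivatives of `V` and `m` are identical and
    -- cancel in the difference.
    rw [h.backstep_L hGN hrd] at h2
    simp only [mRate, backstep_zero]
    set V := lyapunov P D (u r) (backstep K M (u r) (v r))
    -- The two bounds on `κ` enter through the signs `V ≥ 0` and `m < 0`; `κ` itself may be
    -- negative.
    have h4 : κ * V ≤ (D.μ * (1 - D.σ) - gammaConst P D p₁ p₃) * V :=
      mul_le_mul_of_nonneg_right hκ₁ hV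
    have h5 : D.η * m r ≤ κ * m r := mul_le_mul_of_nonpos_right hκ₂ h3.le
    have h6 : ∑ i, (D.ς i - D.A i * Real.exp (-(D.μ * P.L / P.lam i))) * u r P.L i ^ 2 ≤ 0 :=
      Finset.sum_nonpos fun i _ => mul_nonpos_of_nonpos_of_nonneg (hsel i) (sq_nonneg _)
    have h7 := mul_nonpos_of_nonpos_of_nonneg hsel₄ (sq_nonneg (v r 0))
    simp only [Fin.sum_univ_three] at h2 h6 h7 ⊢
    linarith)
  simp only [sub_zero] at h1
  linarith

end IsClosedLoop

end MixedTraffic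

end

/-! ### Conclusion: from `V - m` to the norm of `w` -/

theorem theorem3 (P : MixedTraffic.Plant) (D : MixedTraffic.Design)
    (K : Fin 3 → ℝ × ℝ → ℝ) (M : ℝ × ℝ → ℝ) (G : Fin 3 → ℝ × ℝ → ℝ) (N : ℝ × ℝ → ℝ)
    (hKM : MixedTraffic.IsBacksteppingKernel P K M)
    (hGN : MixedTraffic.IsInverseKernel P K M G N)
    (hA : ∀ i, 0 < D.A i) (hB : 0 < D.B) (hμ : 0 < D.μ) (hσ : 0 < D.σ) (hζ : 0 < D.ζ)
    (hη : D.η ∈ Set.Ioo (0 : ℝ) 1) (hς : ∀ i, D.ς i ∈ Set.Ioo (0 : ℝ) 1)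
    (hς₄ : D.ς₄ ∈ Set.Ioo (0 : ℝ) 1)
    (hsel : ∀ i, D.ς i - D.A i * Real.exp (-(D.μ * P.L / P.lam i)) ≤ 0)
    (hsel₄ : D.ς₄ + (∑ i, D.A i * P.Q i ^ 2) - D.B ≤ 0)
    (p₁ p₂ p₃ p₄ : ℝ) (hp₁ : 0 < p₁) (hp₂ : 0 < p₂) (hp₃ : 0 < p₃) (hp₄ : 0 < p₄)
    (hp₁₂ : MixedTraffic.TransformBounds P K M p₁ p₂)
    (hp₃₄ : MixedTraffic.LyapunovBounds P D p₃ p₄)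
    (u : ℝ → ℝ → Fin 3 → ℝ) (v : ℝ → ℝ → ℝ) (Ud m : ℝ → ℝ) (tk : ℕ → EReal)
    (hcl : MixedTraffic.IsClosedLoop P D K M G N u v Ud m tk) :
    (0 < MixedTraffic.decayRate P D p₁ p₃ →
      MixedTraffic.ExpConverges P.L (min (MixedTraffic.decayRate P D p₁ p₃) D.η / 2)
        (⨆ k, tk k) u v) ∧
    (MixedTraffic.decayRate P D p₁ p₃ ≤ D.η →
      ∀ t ∈ MixedTraffic.timeDomain (⨆ k, tk k),
        MixedTraffic.normSq P.L (u t) (v t) ≤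
          max 1 (p₂ * p₄) / (p₁ * p₃) *
            Real.exp (-(MixedTraffic.decayRate P D p₁ p₃ * t)) *
            (MixedTraffic.normSq P.L (u 0) (v 0) - m 0)) := by
  -- One estimate serves both claims: `κ = min c η` for the first and `κ = c` for the second.
  have bound : ∀ κ, κ ≤ MixedTraffic.decayRate P D p₁ p₃ → κ ≤ D.η →
      ∀ t ∈ MixedTraffic.timeDomain (⨆ k, tk k),
        MixedTraffic.normSq P.L (u t) (v t) ≤ max 1 (p₂ * p₄) / (p₁ * p₃) *
          Real.exp (-(κ * t)) * (MixedTraffic.normSq P.L (u 0) (v 0) - m 0) := by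
    intro κ hκ₁ hκ₂ t ht
    have h0 : (0 : ℝ) ∈ MixedTraffic.timeDomain (⨆ k, tk k) :=
      MixedTraffic.Icc_subset_timeDomain ht (Set.left_mem_Icc.2 ht.1)
    have hm := hcl.m_neg hζ hς hς₄ ht
    have hϑ := fun {r : ℝ} (hr : r ∈ MixedTraffic.timeDomain (⨆ k, tk k)) =>
      hcl.solution.inL2_backstep hr (fun i => (hKM.K_smooth i).continuousOn)
        hKM.M_smooth.continuousOn
    have h1 := hcl.lyapunov_sub_m_le hKM hGN hA hμ hζ hς hς₄ hsel hsel₄ hp₁ hp₃ hp₁₂ hp₃₄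
      hκ₁ hκ₂ ht
    have h2 := (hp₃₄ _ _ (hϑ ht)).1
    have h3 := (hp₃₄ _ _ (hϑ h0)).2
    have h4 := (hp₁₂ _ _ (hcl.solution.inL2 t ht)).1
    have h5 := (hp₁₂ _ _ (hcl.solution.inL2 0 h0)).2
    have hn := MixedTraffic.normSq_nonneg P.L_pos.le (u 0) (v 0)
    set n := MixedTraffic.normSq P.L (u 0) (v 0)
    -- Passing from `V` to the norm of `w` costs `p₂ p₄`, but `-m 0` carries the coefficient `1`;
    -- the maximum covers both.
    have h6 : MixedTraffic.lyapunov P D (u 0) (MixedTraffic.backstep K M (u 0) (v 0)) - m 0 ≤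
        max 1 (p₂ * p₄) * (n - m 0) := by
      have e1 : MixedTraffic.lyapunov P D (u 0) (MixedTraffic.backstep K M (u 0) (v 0)) ≤
          p₂ * p₄ * n := h3.trans (by nlinarith)
      have e2 : p₂ * p₄ * n ≤ max 1 (p₂ * p₄) * n :=
        mul_le_mul_of_nonneg_right (le_max_right _ _) hn
      have e3 : 1 * (-m 0) ≤ max 1 (p₂ * p₄) * (-m 0) :=
        mul_le_mul_of_nonneg_right (le_max_left _ _) (neg_nonneg.2 hcl.m_zero.le)
      linarith
    -- The positive quantity `-m t` is dropped on the left.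
    have h7 : p₁ * p₃ * MixedTraffic.normSq P.L (u t) (v t) ≤
        Real.exp (-(κ * t)) * (max 1 (p₂ * p₄) * (n - m 0)) := by
      have e1 := mul_le_mul_of_nonneg_left h4 hp₃.le
      have e2 := mul_le_mul_of_nonneg_left h6 (Real.exp_pos (-(κ * t))).le
      rw [neg_mul] at h1
      linarith
    rw [div_mul_eq_mul_div, div_mul_eq_mul_div, le_div_iff₀ (mul_pos hp₁ hp₃)]
    linarith
  refine ⟨fun _ => ?_, fun hle => bound _ le_rfl hle⟩
  -- The bound is for the squared norm; its square root halves the rate.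
  refine ⟨Real.sqrt (max 1 (p₂ * p₄) / (p₁ * p₃) *
    (MixedTraffic.normSq P.L (u 0) (v 0) - m 0)), fun t ht => ?_⟩
  have h1 := bound _ (min_le_left _ _) (min_le_right _ _) t ht
  set κ := min (MixedTraffic.decayRate P D p₁ p₃) D.η
  have he : Real.exp (-(κ / 2 * t)) = Real.sqrt (Real.exp (-(κ * t))) := by
    rw [← Real.exp_half]
    congr 1
    ring
  rw [he, ← Real.sqrt_mul' _ (Real.exp_pos _).le]
  refine Real.sqrt_le_sqrt (h1.trans (le_of_eq ?_))
  ring
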